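/- Let $H$ be a complex Hilbert space, $\omega>0$, and let $L^2=L^2([0,\omega],H)$ be the Hilbert space of (classes of) strongly measurable square integrable functions with inner product $\langle x,y\rangle=\frac1\omega\int_0^\omega\langle x(s),y(s)\rangle_H\,ds$. Let $W_2^1=W_2^1([0,\omega],H)$ be the space of functions of the form $y(s)=y(0)+\int_0^s y'(\tau)\,d\tau$, $s\in[0,\omega]$, with $y'\in L^2$. Let $\mathcal V:[0,\omega]\to B(H)$ be such that for every $x\in H$ the function $s\mapsto\mathcal V(s)x$ belongs to $L^2$, and let $\widehat{\mathcal V}(n)\in B(H)$, $n\in\mathbb Z$, be its Fourier coefficients $$\widehat{\mathcal V}(n)x=\frac1\omega\int_0^\omega \mathcal V(s)x\,e^{-i\frac{2\pi n}{\omega}s}\,ds,\qquad x\in H.$$ Assume that $$\sum_{n\in\mathbb Z}\|\widehat{\mathcal V}(n)\|^2<\infty\qquad\text{and}\qquad \sum_{j,\ell\in\mathbb Z}\Big\|\sum_{n\neq\ell}\frac{\widehat{\mathcal V}(j+n)\widehat{\mathcal V}(\ell+n)}{\ell-n}\Big\|^2<\infty .$$ Let $D(L)=\{y\in W_2^1:\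 y(0)=y(\omega)\}$ and $(Ly)(s)=y'(s)-\mathcal V(s)y(\omega-s)$ for $y\in D(L)$. For an interval $\mathcal J\ni 0$ of one of the forms $(-\infty,\infty)$, $(-\infty,\beta]$, $[\alpha,\beta]$ with $\alpha<\beta$, $[\alpha,\infty)$, and $\varphi\in L^2$, consider the mixed problem $$\frac{\partial u(t,s)}{\partial t}=\frac{\partial u(t,s)}{\partial s}-\mathcal V(s)u(t,\omega-s),\quad u(t,0)=u(t,\omega),\quad u(0,s)=\varphi(s),\qquad t\in\mathcal J,\ s\in[0,\omega].$$ Let $u:\mathcal J\times[0,\omega]\to H$ be such that $u(t,\cdot)\in L^2$ for each $t\in\mathcal J$ and $\widetilde u:\mathcal J\to L^2$, $\widetilde u(t)=u(t,\cdot)$, is continuous. Then $u$ is called a *classical solution* if $u$ is continuously differentiable on $\mathcal J\times[0,\omega]$, $\widetilde u$ is continuously differentiable, $\widetilde u(t)\in D(L)$ and $\widetilde u'(t)=L\widetilde u(t)$ for all $t\in\mathcal J$, and $\widetilde u(0)=\varphi$; it is called a *mild solution* if $\int_0^t\widetilde u(\tau)\,d\tau\in D(L)$ and $\widetilde u(t)=\varphi+L\int_0^t\widetilde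 u(\tau)\,d\tau$ for all $t\in\mathcal J$. **Theorem.** The operator $L:D(L)\subset L^2\to L^2$ is well defined (that is, $Ly\in L^2$ for all $y\in D(L)$), and it is the infinitesimal generator of a strongly continuous group of bounded operators $T:\mathbb R\to B(L^2)$. For every such $\mathcal J$, every classical solution $u$ of the mixed problem with initial value $\varphi$ is given by $$u(t,s)=(T(t)\varphi)(s),\qquad t\in\mathcal J,\ s\in[0,\omega]$$ (equality in $L^2$ for each $t$), where $\varphi\in W_2^1$ and $\varphi(0)=\varphi(\omega)$. Every mild solution with initial value $\varphi\in L^2$ is given by the same formula. -/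

import Mathlib

open MeasureTheory Set Filter Topology

noncomputable section

namespace Involution

/-- Normalized Lebesgue measure `(1/ω) ds` on `[0, ω]`; it makes the inner product of
`L²([0, ω], H)` equal to `(1/ω) ∫₀^ω ⟪x(s), y(s)⟫ ds`. -/
def normMeasure (ω : ℝ) : Measure ℝ :=
  Real.toNNReal ω⁻¹ • (volume : Measure ℝ).restrict (Icc 0 ω)

instance (ω : ℝ) : IsFiniteMeasure (normMeasure ω) := by
  unfold normMeasure; infer_instance

/-- The space `L²([0, ω], H)`. -/
abbrev L2 (ω : ℝ) (H : Type*) [NormedAddCommGroup H] : Type _ := Lp H 2 (normMeasure ω)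

section Potential

variable {H : Type*} [NormedAddCommGroup H] [InnerProductSpace ℂ H]

/-- The standing assumption on the potential: each function `s ↦ V(s) x`, `x ∈ H`, is (strongly)
measurable and square integrable on `[0, ω]`. -/
def IsPotential (ω : ℝ) (V : ℝ → H →L[ℂ] H) : Prop :=
  ∀ x : H, MemLp (fun s => V s x) 2 (normMeasure ω)

/-- The exponential `s ↦ exp (-2πi n s / ω)`. -/
def expo (ω : ℝ) (n : ℤ) (s : ℝ) : ℂ :=
  Complex.exp (-(2 * Real.pi * Complex.I * n / ω) * s)

theorem norm_expo (ω : ℝ) (n : ℤ) (s : ℝ) : ‖expo ω n s‖ = 1 := by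
  have : (-(2 * Real.pi * Complex.I * n / ω) * s : ℂ)
      = ((-(2 * Real.pi * n / ω) * s : ℝ) : ℂ) * Complex.I := by
    push_cast; ring
  rw [expo, this, Complex.norm_exp_ofReal_mul_I]

theorem continuous_expo (ω : ℝ) (n : ℤ) : Continuous (expo ω n) := by
  unfold expo; fun_prop

theorem integrable_expo_smul {ω : ℝ} {V : ℝ → H →L[ℂ] H} (hV : IsPotential ω V) (n : ℤ) (x : H) :
    Integrable (fun s => expo ω n s • V s x) (normMeasure ω) := by
  have h1 : Integrable (fun s => V s x) (normMeasure ω) := (hV x).integrable (by norm_num)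
  exact h1.bdd_smul 1 (continuous_expo ω n).aestronglyMeasurable
    (Eventually.of_forall fun s => (norm_expo ω n s).le)

/-- The map `x ↦ exp (-2πi n · / ω) V(·) x` from `H` to `L¹([0, ω], H)`. -/
def expoSmulL1 {ω : ℝ} {V : ℝ → H →L[ℂ] H} (hV : IsPotential ω V) (n : ℤ) :
    H →ₗ[ℂ] (Lp H 1 (normMeasure ω)) where
  toFun x := (integrable_expo_smul hV n x).toL1 _
  map_add' x y := by
    rw [← Integrable.toL1_add]
    congr 1
    funext s
    simp
  map_smul' c x := by
    rw [RingHom.id_apply, ← Integrable.toL1_smul]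
    congr 1
    funext s
    simp [smul_comm c]

variable [CompleteSpace H]

/-- Boundedness, from the closed graph theorem. -/
theorem continuous_expoSmulL1 {ω : ℝ} {V : ℝ → H →L[ℂ] H} (hV : IsPotential ω V) (n : ℤ) :
    Continuous (expoSmulL1 hV n) := by
  refine LinearMap.continuous_of_seq_closed_graph _ fun u x y hu hy => ?_
  obtain ⟨ns, hns, hae⟩ := (tendstoInMeasure_of_tendsto_Lp hy).exists_seq_tendsto_ae
  refine Lp.ext ?_
  have h1 : ∀ k, ((expoSmulL1 hV n (u k) : Lp H 1 (normMeasure ω)) : ℝ → H)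
      =ᵐ[normMeasure ω] fun s => expo ω n s • V s (u k) :=
    fun k => Integrable.coeFn_toL1 (integrable_expo_smul hV n (u k))
  have h2 : ((expoSmulL1 hV n x : Lp H 1 (normMeasure ω)) : ℝ → H)
      =ᵐ[normMeasure ω] fun s => expo ω n s • V s x :=
    Integrable.coeFn_toL1 (integrable_expo_smul hV n x)
  filter_upwards [hae, ae_all_iff.2 h1, h2] with s hs h1s h2s
  rw [h2s]
  refine tendsto_nhds_unique hs ?_
  have : Tendsto (fun k => expo ω n s • V s (u (ns k))) atTop (𝓝 (expo ω n s • V s x)) :=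
    (((V s).continuous.tendsto x).comp (hu.comp hns.tendsto_atTop)).const_smul _
  exact this.congr fun k => (h1s (ns k)).symm

/-- The Fourier coefficient `V̂(n) ∈ B(H)`,
`V̂(n) x = (1/ω) ∫₀^ω V(s) x exp (-2πi n s / ω) ds`. -/
def potCoeff {ω : ℝ} {V : ℝ → H →L[ℂ] H} (hV : IsPotential ω V) (n : ℤ) : H →L[ℂ] H where
  toFun x := ∫ s, expo ω n s • V s x ∂(normMeasure ω)
  map_add' x y := by
    rw [← integral_add (integrable_expo_smul hV n x) (integrable_expo_smul hV n y)]
    simp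
  map_smul' c x := by
    rw [RingHom.id_apply, ← integral_smul]
    simp [smul_comm c]
  cont := by
    have h := continuous_integral.comp (continuous_expoSmulL1 hV n)
    refine h.congr fun x => ?_
    exact integral_congr_ae (Integrable.coeFn_toL1 (integrable_expo_smul hV n x))

end Potential

section Operator

variable {H : Type*} [NormedAddCommGroup H] [InnerProductSpace ℂ H]

/-- `f` is a function of the Sobolev class `W₂¹([0, ω], H)` with derivative `g`: it is the
indefinite integral of the square integrable function `g` on `[0, ω]`. -/
structure HasSobolevDeriv (ω : ℝ) (f g : ℝ → H) : Prop where
  memLp : MemLp g 2 (normMeasure ω)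
  eq_integral : ∀ s ∈ Icc 0 ω, f s = f 0 + ∫ τ in (0 : ℝ)..s, g τ

theorem intervalIntegrable_of_memLp {H : Type*} [NormedAddCommGroup H] {ω : ℝ} {g : ℝ → H} (hg : MemLp g 2 (normMeasure ω))
    {s : ℝ} (hs : s ∈ Icc 0 ω) : IntervalIntegrable g volume 0 s := by
  rcases hs.1.eq_or_lt with h | h
  · subst h; simp
  have hω : 0 < ω := h.trans_le hs.2
  have h1 : Integrable g (normMeasure ω) := hg.integrable (by norm_num)
  have h2 : Integrable g ((volume : Measure ℝ).restrict (Icc 0 ω)) := by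
    have hc : Real.toNNReal ω⁻¹ ≠ 0 := by simpa using hω
    have := (integrable_smul_measure (c := ((Real.toNNReal ω⁻¹ : NNReal) : ENNReal))
      (by simpa using hω) (by simp)).1 h1
    exact this
  rw [intervalIntegrable_iff_integrableOn_Icc_of_le hs.1]
  exact IntegrableOn.mono_set h2 (Icc_subset_Icc_right hs.2)

theorem HasSobolevDeriv.add {ω : ℝ} {f g f' g' : ℝ → H} (h : HasSobolevDeriv ω f g)
    (h' : HasSobolevDeriv ω f' g') : HasSobolevDeriv ω (f + f') (g + g') where
  memLp := h.memLp.add h'.memLp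
  eq_integral s hs := by
    simp only [Pi.add_apply]
    rw [intervalIntegral.integral_add (intervalIntegrable_of_memLp h.memLp hs)
      (intervalIntegrable_of_memLp h'.memLp hs), h.eq_integral s hs, h'.eq_integral s hs]
    abel

theorem HasSobolevDeriv.smul {ω : ℝ} {f g : ℝ → H} (c : ℂ) (h : HasSobolevDeriv ω f g) :
    HasSobolevDeriv ω (c • f) (c • g) where
  memLp := h.memLp.const_smul c
  eq_integral s hs := by
    simp only [Pi.smul_apply]
    rw [intervalIntegral.integral_smul, h.eq_integral s hs, smul_add]

theorem HasSobolevDeriv.zero (ω : ℝ) : HasSobolevDeriv ω (0 : ℝ → H) 0 where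
  memLp := MemLp.zero
  eq_integral s _ := by simp

/-- `D(L) = {y ∈ W₂¹ : y(0) = y(ω)}`, as a subspace of `L²([0, ω], H)`. -/
def periodicSobolev (ω : ℝ) (H : Type*) [NormedAddCommGroup H] [InnerProductSpace ℂ H] :
    Submodule ℂ (L2 ω H) where
  carrier := {y | ∃ f g : ℝ → H, HasSobolevDeriv ω f g ∧ f 0 = f ω ∧ y =ᵐ[normMeasure ω] f}
  zero_mem' := ⟨0, 0, .zero ω, rfl, Lp.coeFn_zero _ _ _⟩
  add_mem' := by
    rintro y y' ⟨f, g, h, hp, hy⟩ ⟨f', g', h', hp', hy'⟩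
    exact ⟨f + f', g + g', h.add h', by simp [hp, hp'], (Lp.coeFn_add y y').trans (hy.add hy')⟩
  smul_mem' := by
    rintro c y ⟨f, g, h, hp, hy⟩
    exact ⟨c • f, c • g, h.smul c, by simp [hp], (Lp.coeFn_smul c y).trans (hy.const_smul c)⟩

/-- The graph of `L`: pairs `(y, z)` of elements of `L²([0, ω], H)` such that `y` belongs to `W₂¹`,
is periodic, and `z(s) = y'(s) - V(s) y(ω - s)` for almost all `s ∈ [0, ω]`. -/
def opGraph (ω : ℝ) (V : ℝ → H →L[ℂ] H) : Submodule ℂ (L2 ω H × L2 ω H) where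
  carrier := {p | ∃ f g : ℝ → H, HasSobolevDeriv ω f g ∧ f 0 = f ω ∧ p.1 =ᵐ[normMeasure ω] f ∧
    p.2 =ᵐ[normMeasure ω] fun s => g s - V s (f (ω - s))}
  zero_mem' := by
    refine ⟨0, 0, .zero ω, rfl, Lp.coeFn_zero _ _ _, ?_⟩
    filter_upwards [Lp.coeFn_zero H 2 (normMeasure ω)] with s hs
    simpa using hs
  add_mem' := by
    rintro ⟨y, z⟩ ⟨y', z'⟩ ⟨f, g, h, hp, hy, hz⟩ ⟨f', g', h', hp', hy', hz'⟩
    refine ⟨f + f', g + g', h.add h', by simp [hp, hp'],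
      (Lp.coeFn_add y y').trans (hy.add hy'), ?_⟩
    filter_upwards [Lp.coeFn_add z z', hz, hz'] with s h1 h2 h3
    simp only [Prod.snd_add, h1, Pi.add_apply, map_add]
    rw [h2, h3]
    abel
  smul_mem' := by
    rintro c ⟨y, z⟩ ⟨f, g, h, hp, hy, hz⟩
    refine ⟨c • f, c • g, h.smul c, by simp [hp],
      (Lp.coeFn_smul c y).trans (hy.const_smul c), ?_⟩
    filter_upwards [Lp.coeFn_smul c z, hz] with s h1 h2
    simp only [Prod.smul_snd, h1, Pi.smul_apply, map_smul]
    rw [h2, smul_sub]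

/-- The graph is single-valued: the derivative of a Sobolev function is determined almost
everywhere. -/
theorem opGraph_fst_eq_zero [CompleteSpace H] {ω : ℝ} (hω : 0 < ω) {V : ℝ → H →L[ℂ] H}
    (p : L2 ω H × L2 ω H) (hp : p ∈ opGraph ω V) (h0 : p.1 = 0) : p.2 = 0 := by
  obtain ⟨y, z⟩ := p
  obtain ⟨f, g, h, -, hy, hz⟩ := hp
  simp only at h0 hy hz ⊢
  subst h0
  have hc : Real.toNNReal ω⁻¹ ≠ 0 := by simpa using hω
  have hac : (volume : Measure ℝ).restrict (Icc 0 ω) ≪ normMeasure ω :=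
    Measure.absolutelyContinuous_smul (c := ((Real.toNNReal ω⁻¹ : NNReal) : ENNReal))
      (by simpa using hω)
  have hca : normMeasure ω ≪ (volume : Measure ℝ).restrict (Icc 0 ω) :=
    Measure.smul_absolutelyContinuous (c := ((Real.toNNReal ω⁻¹ : NNReal) : ENNReal))
  have hgi := intervalIntegrable_of_memLp h.memLp (right_mem_Icc.2 hω.le)
  have hfc : ContinuousOn f (Icc 0 ω) := by
    have h1 : ContinuousOn (fun s => f 0 + ∫ τ in (0 : ℝ)..s, g τ) (Icc 0 ω) := by
      have := intervalIntegral.continuousOn_primitive_interval' hgi left_mem_uIcc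
      rw [uIcc_of_le hω.le] at this
      exact continuousOn_const.add this
    exact h1.congr h.eq_integral
  have hf0 : EqOn f 0 (Icc 0 ω) := by
    refine Measure.eqOn_Icc_of_ae_eq volume hω.ne ?_ hfc continuousOn_const
    exact hac.ae_eq (hy.symm.trans (Lp.coeFn_zero _ _ _))
  have hg0 : ∀ᵐ s, s ∈ Ioo 0 ω → g s = 0 := by
    filter_upwards [hgi.ae_hasDerivAt_integral] with s hs hsI
    have hd := hs (by rw [uIcc_of_le hω.le]; exact Ioo_subset_Icc_self hsI) 0 left_mem_uIcc
    refine hd.unique ((hasDerivAt_const s (0 : H)).congr_of_eventuallyEq ?_)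
    filter_upwards [isOpen_Ioo.mem_nhds hsI] with t ht
    have htI := Ioo_subset_Icc_self ht
    have := h.eq_integral t htI
    rw [hf0 htI, hf0 (left_mem_Icc.2 hω.le)] at this
    simpa using this.symm
  have hg1 : ∀ᵐ s ∂(volume : Measure ℝ).restrict (Icc 0 ω), s ∈ Icc 0 ω ∧ g s = 0 := by
    rw [← Measure.restrict_congr_set Ioo_ae_eq_Icc]
    refine (ae_restrict_iff' measurableSet_Ioo).2 ?_
    filter_upwards [hg0] with s hs hsI
    exact ⟨Ioo_subset_Icc_self hsI, hs hsI⟩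
  refine Lp.ext ?_
  filter_upwards [hz, hca.ae_le hg1, Lp.coeFn_zero H 2 (normMeasure ω)] with s h1 h2 h3
  have h4 : f (ω - s) = 0 := hf0 ⟨by linarith [h2.1.2], by linarith [h2.1.1]⟩
  rw [h1, h2.2, h4, h3]
  simp

/-- The operator `(L y)(s) = y'(s) - V(s) y(ω - s)` in `L²([0, ω], H)`; its domain consists of the
`y` in `periodicSobolev ω H` for which the right-hand side is square integrable. -/
def opL (ω : ℝ) (V : ℝ → H →L[ℂ] H) : L2 ω H →ₗ.[ℂ] L2 ω H := (opGraph ω V).toLinearPMap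

theorem opL_graph [CompleteSpace H] {ω : ℝ} (hω : 0 < ω) (V : ℝ → H →L[ℂ] H) :
    (opL ω V).graph = opGraph ω V :=
  Submodule.toLinearPMap_graph_eq _ (fun p hp => opGraph_fst_eq_zero hω p hp)

end Operator

section Groups

variable {X : Type*} [NormedAddCommGroup X] [NormedSpace ℂ X]

/-- `T : ℝ → B(X)` is a strongly continuous group of bounded operators. -/
structure IsC0Group (T : ℝ → X →L[ℂ] X) : Prop where
  zero : T 0 = ContinuousLinearMap.id ℂ X
  add : ∀ s t, T (s + t) = (T s).comp (T t)
  continuous : ∀ x, Continuous fun t => T t x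

/-- `A` is the infinitesimal generator of `T`: `x ∈ D(A)` and `A x = y` if and only if
`(T(t) x - x) / t → y` as `t → 0`. -/
def IsGenerator (A : X →ₗ.[ℂ] X) (T : ℝ → X →L[ℂ] X) : Prop :=
  ∀ x y : X, (∃ hx : x ∈ A.domain, A ⟨x, hx⟩ = y) ↔
    Tendsto (fun t : ℝ => (t : ℂ)⁻¹ • (T t x - x)) (𝓝[≠] 0) (𝓝 y)

end Groups

section Solutions

variable {H : Type*} [NormedAddCommGroup H] [InnerProductSpace ℂ H]

/-- The time intervals: `(-∞, ∞)`, `(-∞, β]`, `[α, β]` with `α < β`, or `[α, ∞)`, containing `0`. -/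
def IsTimeInterval (J : Set ℝ) : Prop :=
  0 ∈ J ∧ (J = univ ∨ (∃ β, J = Iic β) ∨ (∃ α β, α < β ∧ J = Icc α β) ∨ ∃ α, J = Ici α)

/-- `u : J × [0, ω] → H` belongs to `C(J, L²)` and `v : J → L²` is its associated function. -/
def IsAssociated (ω : ℝ) (J : Set ℝ) (u : ℝ → ℝ → H) (v : ℝ → L2 ω H) : Prop :=
  ContinuousOn v J ∧ ∀ t ∈ J, v t =ᵐ[normMeasure ω] u t

/-- Classical solutions of `u_t(t, s) = u_s(t, s) - V(s) u(t, ω - s)`, `u(t, 0) = u(t, ω)`,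
`u(0, s) = φ(s)` on `J`. -/
def IsClassicalSolution (ω : ℝ) (V : ℝ → H →L[ℂ] H) (J : Set ℝ) (φ : L2 ω H)
    (u : ℝ → ℝ → H) : Prop :=
  ContDiffOn ℝ 1 (fun p : ℝ × ℝ => u p.1 p.2) (J ×ˢ Icc 0 ω) ∧
  ∃ v : ℝ → L2 ω H, IsAssociated ω J u v ∧ ContDiffOn ℝ 1 v J ∧
    (∀ t ∈ J, ∃ ht : v t ∈ (opL ω V).domain, HasDerivWithinAt v (opL ω V ⟨v t, ht⟩) J t) ∧
    v 0 = φ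

/-- Mild solutions of the same problem. -/
def IsMildSolution (ω : ℝ) (V : ℝ → H →L[ℂ] H) (J : Set ℝ) (φ : L2 ω H)
    (u : ℝ → ℝ → H) : Prop :=
  ∃ v : ℝ → L2 ω H, IsAssociated ω J u v ∧
    ∀ t ∈ J, ∃ ht : (∫ τ in (0 : ℝ)..t, v τ) ∈ (opL ω V).domain,
      v t = φ + opL ω V ⟨∫ τ in (0 : ℝ)..t, v τ, ht⟩

end Solutions

end Involution

/-! Fourier series identify L² with ℓ²(ℤ, H). With θ = 2π/ω and a(n) the Fourier coefficients of the
potential, differentiation becomes A = diag(iθn). Reflection exchanges the modes m and -m, so the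
potential term becomes the Hankel matrix B = (a(n + m)) (`mem_opGraph_iff`). B is only known to map
ℓ¹ into ℓ², but D(A) lies in ℓ¹ by Cauchy–Schwarz; this makes L defined on all periodic Sobolev
functions (`opL_domain_eq`).

B is then traded for a bounded operator by a similarity. The matrix Γ = (a(n + m)/(iθ(n - m))), zero
on the diagonal, solves AΓ - ΓA = B - diag(a(2n)). The first hypothesis makes Γ square summable, and
the second says exactly that BΓ is. Deleting finitely many columns of Γ makes its norm less than 1
and changes the commutator by a bounded operator, so (A - B)(1 + Γ) = (1 + Γ)(A - C) with C bounded
(`exists_similarity`). That no domain is lost follows because, for large λ, λ - A + B is injective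
and λ - A + C is onto (`hankelGraph_iff`).

A generates the diagonal group `rotation`; bounded perturbation (`IsC0Group.exists_sub`) and
conjugation (`IsC0Group.conj`) carry this to L. A solution v is an orbit because r ↦ T(t - r) v(r)
is constant; a mild solution is treated through its primitive. -/

namespace Involution

/-! ### Strongly continuous groups: orbits, bounded perturbation, conjugation -/

section GroupTheory

variable {X : Type*} [NormedAddCommGroup X] [NormedSpace ℂ X]

section Algebra

variable {T : ℝ → X →L[ℂ] X}

theorem IsC0Group.add_apply (hT : IsC0Group T) (s t : ℝ) (x : X) : T (s + t) x = T s (T t x) := by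
  rw [hT.add]; rfl

theorem IsC0Group.zero_apply (hT : IsC0Group T) (x : X) : T 0 x = x := by
  rw [hT.zero]; rfl

theorem IsC0Group.exists_norm_le [CompleteSpace X] (hT : IsC0Group T) (a b : ℝ) :
    ∃ M, ∀ t ∈ Icc a b, ‖T t‖ ≤ M := by
  obtain ⟨M, hM⟩ := banach_steinhaus (g := fun t : Icc a b => T t) fun x => by
    obtain ⟨C, hC⟩ := isCompact_Icc.exists_bound_of_continuousOn (s := Icc a b)
      (hT.continuous x).continuousOn
    exact ⟨C, fun t => hC t t.2⟩
  exact ⟨M, fun t ht => hM ⟨t, ht⟩⟩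

/-- A strongly continuous group is jointly continuous. -/
theorem IsC0Group.tendsto_apply [CompleteSpace X] (hT : IsC0Group T) {ι : Type*} {l : Filter ι}
    {f : ι → ℝ} {g : ι → X} {t : ℝ} {x : X} (hf : Tendsto f l (𝓝 t)) (hg : Tendsto g l (𝓝 x)) :
    Tendsto (fun i => T (f i) (g i)) l (𝓝 (T t x)) := by
  obtain ⟨M, hM⟩ := hT.exists_norm_le (t - 1) (t + 1)
  have h1 : Tendsto (fun i => T (f i) (g i - x)) l (𝓝 0) := by
    refine squeeze_zero_norm' (a := fun i => M * ‖g i - x‖) ?_ ?_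
    · filter_upwards [hf (Icc_mem_nhds (sub_one_lt t) (lt_add_one t))] with i hi
      exact (T (f i)).le_of_opNorm_le (hM _ hi) _
    · simpa using (tendsto_iff_norm_sub_tendsto_zero.1 hg).const_mul M
  have h2 : Tendsto (fun i => T (f i) x) l (𝓝 (T t x)) := ((hT.continuous x).tendsto t).comp hf
  simpa using h1.add h2

theorem IsC0Group.continuous_apply [CompleteSpace X] (hT : IsC0Group T) {ι : Type*}
    [TopologicalSpace ι] {f : ι → ℝ} {g : ι → X} (hf : Continuous f) (hg : Continuous g) :
    Continuous fun i => T (f i) (g i) :=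
  continuous_iff_continuousAt.2 fun i => hT.tendsto_apply (hf.tendsto i) (hg.tendsto i)

end Algebra

section Derivative

variable [NormedSpace ℝ X] [IsScalarTower ℝ ℂ X] {T : ℝ → X →L[ℂ] X}

theorem IsC0Group.hasDerivAt_zero_iff (hT : IsC0Group T) (x y : X) :
    HasDerivAt (fun t => T t x) y 0 ↔
      Tendsto (fun t : ℝ => (t : ℂ)⁻¹ • (T t x - x)) (𝓝[≠] 0) (𝓝 y) := by
  rw [hasDerivAt_iff_tendsto_slope_zero]
  have (t : ℝ) : t⁻¹ • (T (0 + t) x - T 0 x) = (t : ℂ)⁻¹ • (T t x - x) := by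
    rw [zero_add, hT.zero_apply, ← algebraMap_smul ℂ t⁻¹]
    simp
  simp_rw [this]

theorem isGenerator_iff (hT : IsC0Group T) (A : X →ₗ.[ℂ] X) :
    IsGenerator A T ↔
      ∀ x y, (∃ hx : x ∈ A.domain, A ⟨x, hx⟩ = y) ↔ HasDerivAt (fun t => T t x) y 0 := by
  simp_rw [IsGenerator, hT.hasDerivAt_zero_iff]

theorem IsC0Group.hasDerivAt_orbit (hT : IsC0Group T) {x y : X}
    (h : HasDerivAt (fun t => T t x) y 0) (t : ℝ) : HasDerivAt (fun t => T t x) (T t y) t := by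
  rw [hT.hasDerivAt_zero_iff] at h
  rw [hasDerivAt_iff_tendsto_slope_zero]
  refine (((T t).continuous.tendsto y).comp h).congr fun s => ?_
  rw [Function.comp_apply, map_smul, map_sub, hT.add_apply, ← algebraMap_smul ℂ s⁻¹]
  simp

/-- Derivative of `ρ ↦ T (f ρ) (w ρ)` when `w r` lies in the domain of the generator. -/
theorem IsC0Group.hasDerivWithinAt_apply_sub [CompleteSpace X] (hT : IsC0Group T) {J : Set ℝ}
    {w : ℝ → X} {w' y : X} {r : ℝ} (t : ℝ) (hw : HasDerivWithinAt w w' J r)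
    (hy : HasDerivAt (fun t => T t (w r)) y 0) :
    HasDerivWithinAt (fun ρ => T (t - ρ) (w ρ)) (T (t - r) (w' - y)) J r := by
  have h1 : HasDerivAt (fun ρ => T (t - ρ) (w r)) (-T (t - r) y) r := by
    simpa [Function.comp_def] using
      (hT.hasDerivAt_orbit hy (t - r)).scomp r ((hasDerivAt_id r).const_sub t)
  have h1' := hasDerivWithinAt_iff_tendsto_slope.1 (h1.hasDerivWithinAt (s := J))
  rw [hasDerivWithinAt_iff_tendsto_slope] at hw ⊢
  -- Product rule: the increment is T(t - ρ)(w(ρ) - w(r)) + (T(t - ρ) - T(t - r)) w(r). Joint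
  -- continuity handles the first part, the orbit derivative the second.
  have h2 : Tendsto (fun ρ => T (t - ρ) (slope w r ρ)) (𝓝[J \ {r}] r) (𝓝 (T (t - r) w')) :=
    hT.tendsto_apply (tendsto_nhdsWithin_of_tendsto_nhds
      ((continuous_const.sub continuous_id).tendsto r)) hw
  have h3 := h2.add h1'
  rw [← sub_eq_add_neg, ← map_sub] at h3
  refine h3.congr fun ρ => ?_
  simp only [slope, vsub_eq_sub]
  rw [← algebraMap_smul ℂ (ρ - r)⁻¹, map_smul, map_sub, algebraMap_smul, ← smul_add]
  simp

/-- Variation of constants with constant inhomogeneity `ψ`. -/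
theorem IsC0Group.eq_of_hasDerivWithinAt [CompleteSpace X] (hT : IsC0Group T) {w Aw : ℝ → X}
    {ψ : X} {t : ℝ} (hw : ∀ r ∈ uIcc 0 t, HasDerivWithinAt w (Aw r + ψ) (uIcc 0 t) r)
    (hA : ∀ r ∈ uIcc 0 t, HasDerivAt (fun s => T s (w r)) (Aw r) 0) :
    w t = T t (w 0) + ∫ τ in (0 : ℝ)..t, T τ ψ := by
  -- The derivative is T(t - r)(Aw + ψ - Aw) - T(t - r)ψ = 0; comparing r = 0 with r = t gives the
  -- formula.
  set Φ : ℝ → X := fun r => T (t - r) (w r) + ∫ τ in (0 : ℝ)..(t - r), T τ ψ with hΦ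
  have hd : ∀ r ∈ uIcc 0 t, HasDerivWithinAt Φ 0 (uIcc 0 t) r := fun r hr => by
    have h1 := hT.hasDerivWithinAt_apply_sub t (hw r hr) (hA r hr)
    have h2 : HasDerivAt (fun r => ∫ τ in (0 : ℝ)..(t - r), T τ ψ) (-T (t - r) ψ) r := by
      have := intervalIntegral.integral_hasDerivAt_right
        ((hT.continuous ψ).intervalIntegrable 0 (t - r))
        ((hT.continuous ψ).stronglyMeasurableAtFilter _ _) (hT.continuous ψ).continuousAt
      simpa [Function.comp_def] using this.scomp r ((hasDerivAt_id r).const_sub t)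
    simpa using h1.fun_add h2.hasDerivWithinAt
  have hc : Φ t = Φ 0 := by
    have := (convex_uIcc (0 : ℝ) t).norm_image_sub_le_of_norm_hasDerivWithin_le (C := 0) hd
      (by simp) left_mem_uIcc right_mem_uIcc
    simpa [sub_eq_zero] using this
  simpa [hΦ, hT.zero_apply] using hc

end Derivative

section Evolution

variable [NormedSpace ℝ X] [IsScalarTower ℝ ℂ X]

/-- Terms of the Dyson series of `w' = c(t) w`, `w(0) = x`. -/
def dysonTerm (c : ℝ → X →L[ℂ] X) (x : X) : ℕ → ℝ → X
  | 0 => fun _ => x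
  | n + 1 => fun t => ∫ s in (0 : ℝ)..t, c s (dysonTerm c x n s)

variable {c : ℝ → X →L[ℂ] X} (hc : ∀ w : ℝ → X, Continuous w → Continuous fun t => c t (w t))

omit [IsScalarTower ℝ ℂ X] in
include hc in
theorem continuous_dysonTerm (x : X) (n : ℕ) : Continuous (dysonTerm c x n) := by
  induction n with
  | zero => exact continuous_const
  | succ n ih =>
    exact intervalIntegral.continuous_primitive
      (fun a b => (hc _ ih).intervalIntegrable a b) 0

omit [IsScalarTower ℝ ℂ X] in
include hc in
theorem hasDerivAt_dysonTerm_succ [CompleteSpace X] (x : X) (n : ℕ) (t : ℝ) :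
    HasDerivAt (dysonTerm c x (n + 1)) (c t (dysonTerm c x n t)) t := by
  have h := hc _ (continuous_dysonTerm hc x n)
  exact intervalIntegral.integral_hasDerivAt_right (h.intervalIntegrable 0 t)
    (h.stronglyMeasurableAtFilter _ _) h.continuousAt

omit [IsScalarTower ℝ ℂ X] in
-- Each integration of |s|^n contributes the factor 1/(n + 1) that builds up the factorial.
theorem norm_dysonTerm_le {K : ℝ} (hK : ∀ t, ‖c t‖ ≤ K) (x : X) (n : ℕ) (t : ℝ) :
    ‖dysonTerm c x n t‖ ≤ (K * |t|) ^ n / n.factorial * ‖x‖ := by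
  have hK0 : 0 ≤ K := (norm_nonneg _).trans (hK 0)
  induction n generalizing t with
  | zero => simp [dysonTerm]
  | succ n ih =>
    have hint : ∫ s in uIoc 0 t, |s| ^ n = |t| ^ (n + 1) / (n + 1) := by
      simpa using integral_pow_abs_sub_uIoc (a := 0) (b := t) n
    calc ‖dysonTerm c x (n + 1) t‖
        ≤ |∫ s in (0 : ℝ)..t, K ^ (n + 1) / n.factorial * ‖x‖ * |s| ^ n| := by
          refine intervalIntegral.norm_integral_le_abs_of_norm_le ?_
            (Continuous.intervalIntegrable (by fun_prop) _ _)
          refine Eventually.of_forall fun s => ?_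
          calc ‖c s (dysonTerm c x n s)‖ ≤ K * ((K * |s|) ^ n / n.factorial * ‖x‖) :=
                (c s).le_of_opNorm_le_of_le (hK s) (ih s)
            _ = _ := by rw [mul_pow]; ring
      _ = (K * |t|) ^ (n + 1) / (n + 1).factorial * ‖x‖ := by
          rw [intervalIntegral.integral_const_mul, abs_mul,
            intervalIntegral.abs_intervalIntegral_eq, hint, abs_of_nonneg (by positivity),
            abs_of_nonneg (by positivity), mul_pow, Nat.factorial_succ]
          push_cast
          field_simp

omit [IsScalarTower ℝ ℂ X] in
include hc in
theorem hasDerivAt_tsum_dysonTerm [CompleteSpace X] {K : ℝ} (hK : ∀ t, ‖c t‖ ≤ K) (x : X)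
    (t : ℝ) : HasDerivAt (fun t => ∑' n, dysonTerm c x n t) (c t (∑' n, dysonTerm c x n t)) t := by
  have hK0 : 0 ≤ K := (norm_nonneg _).trans (hK 0)
  have hs (s : ℝ) : Summable fun n => dysonTerm c x n s :=
    .of_norm_bounded ((Real.summable_pow_div_factorial (K * |s|)).mul_right ‖x‖)
      fun n => norm_dysonTerm_le hK x n s
  have hsplit : (fun s => ∑' n, dysonTerm c x n s) = fun s => x + ∑' n, dysonTerm c x (n + 1) s :=
    funext fun s => (hs s).tsum_eq_zero_add
  -- Termwise differentiation needs a bound uniform in s, so it is carried out on a bounded ball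
  -- around 0.
  have hx : t ∈ Metric.ball (0 : ℝ) (|t| + 1) := by simp
  rw [hsplit, (c t).map_tsum (hs t)]
  refine (hasDerivAt_tsum_of_isPreconnected (g' := fun n s => c s (dysonTerm c x n s))
    (((Real.summable_pow_div_factorial (K * (|t| + 1))).mul_right ‖x‖).mul_left K)
    Metric.isOpen_ball (convex_ball (0 : ℝ) (|t| + 1)).isPreconnected
    (fun n s _ => hasDerivAt_dysonTerm_succ hc x n s) (fun n s hs => ?_) hx
    ((summable_nat_add_iff 1).2 (hs t)) hx).const_add x
  have hs' : |s| ≤ |t| + 1 := by simpa using (Metric.mem_ball.1 hs).le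
  refine (c s).le_of_opNorm_le_of_le (hK s) ((norm_dysonTerm_le hK x n s).trans ?_)
  gcongr

omit [IsScalarTower ℝ ℂ X] in
-- Uniqueness gives linearity of the evolution in the initial value, and later the group law of the
-- perturbed group.
theorem eq_of_hasDerivAt_linear {K : ℝ} (hK : ∀ t, ‖c t‖ ≤ K) {f g : ℝ → X}
    (hf : ∀ t, HasDerivAt f (c t (f t)) t) (hg : ∀ t, HasDerivAt g (c t (g t)) t)
    (h0 : f 0 = g 0) : f = g :=
  ODE_solution_unique_univ (v := fun t x => c t x) (K := K.toNNReal) (s := fun _ => univ) (t₀ := 0)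
    (fun t => (((c t).lipschitz).weaken
      (by rw [← norm_toNNReal]; exact Real.toNNReal_le_toNNReal (hK t))).lipschitzOnWith)
    (fun t => ⟨hf t, mem_univ _⟩) (fun t => ⟨hg t, mem_univ _⟩) h0

include hc in
/-- A linear equation with strongly continuous bounded coefficient has an evolution operator. -/
theorem exists_evolution [CompleteSpace X] {K : ℝ} (hK : ∀ t, ‖c t‖ ≤ K) :
    ∃ W : ℝ → X →L[ℂ] X, W 0 = ContinuousLinearMap.id ℂ X ∧
      ∀ x t, HasDerivAt (fun t => W t x) (c t (W t x)) t := by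
  set f : X → ℝ → X := fun x t => ∑' n, dysonTerm c x n t
  have hd (x : X) (t : ℝ) : HasDerivAt (f x) (c t (f x t)) t := hasDerivAt_tsum_dysonTerm hc hK x t
  have h0 (x : X) : f x 0 = x := by
    refine (tsum_eq_single 0 fun n hn => ?_).trans rfl
    obtain ⟨m, rfl⟩ := Nat.exists_eq_succ_of_ne_zero hn
    simp [dysonTerm]
  have hadd (x y : X) : f (x + y) = f x + f y :=
    eq_of_hasDerivAt_linear hK (hd _) (fun t => by simpa using (hd x t).add (hd y t)) (by simp [h0])
  have hsmul (a : ℂ) (x : X) : f (a • x) = a • f x :=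
    have : SMulCommClass ℝ ℂ X := IsScalarTower.to_smulCommClass
    eq_of_hasDerivAt_linear hK (hd _) (fun t => by simpa using (hd x t).const_smul a)
      (by simp [h0])
  have hs (x : X) (t : ℝ) : ‖f x t‖ ≤ (∑' n : ℕ, (K * |t|) ^ n / n.factorial) * ‖x‖ :=
    tsum_of_norm_bounded ((Real.summable_pow_div_factorial (K * |t|)).hasSum.mul_right ‖x‖)
      fun n => norm_dysonTerm_le hK x n t
  refine ⟨fun t => LinearMap.mkContinuous
    { toFun := fun x => f x t
      map_add' := fun x y => congrFun (hadd x y) t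
      map_smul' := fun a x => congrFun (hsmul a x) t } _ fun x => hs x t, ?_, hd⟩
  ext x
  exact h0 x

end Evolution

section Perturbation

variable [NormedSpace ℝ X] [IsScalarTower ℝ ℂ X] [CompleteSpace X]

/-- Bounded perturbation of the generator of a group of isometries. -/
theorem IsC0Group.exists_sub {S : ℝ → X →L[ℂ] X} (hS : IsC0Group S) (hS1 : ∀ t, ‖S t‖ ≤ 1)
    (C : X →L[ℂ] X) :
    ∃ T : ℝ → X →L[ℂ] X, IsC0Group T ∧ ∀ x y,
      HasDerivAt (fun t => T t x) y 0 ↔ HasDerivAt (fun t => S t x) (y + C x) 0 := by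
  -- Interaction picture: if T is the perturbed group, W(t) = S(-t)T(t) should solve W' = cW, an
  -- equation with bounded coefficient even though the generator of S may be unbounded.
  set c : ℝ → X →L[ℂ] X := fun t => -((S (-t)).comp (C.comp (S t))) with hcdef
  have hK (t : ℝ) : ‖c t‖ ≤ ‖C‖ := by
    rw [hcdef, norm_neg]
    calc _ ≤ ‖S (-t)‖ * (‖C‖ * ‖S t‖) := (ContinuousLinearMap.opNorm_comp_le _ _).trans
          (by gcongr; exact ContinuousLinearMap.opNorm_comp_le _ _)
      _ ≤ 1 * (‖C‖ * 1) := by gcongr <;> exact hS1 _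
      _ = _ := by ring
  have hc (w : ℝ → X) (hw : Continuous w) : Continuous fun t => c t (w t) :=
    (hS.continuous_apply continuous_neg
      (C.continuous.comp (hS.continuous_apply continuous_id hw))).neg
  obtain ⟨W, hW0, hW⟩ := exists_evolution hc hK
  have hWc (x : X) : Continuous fun t => W t x :=
    continuous_iff_continuousAt.2 fun t => (hW x t).continuousAt
  refine ⟨fun t => (S t).comp (W t), ⟨by simp [hW0, hS.zero], fun s t => ?_,
    fun x => hS.continuous_apply continuous_id (hWc x)⟩, fun x y => ?_⟩
  · ext x
    -- Both sides solve the same equation in s, because c(s)S(t) = S(t)c(s + t).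
    have h1 : (fun s => S t (W (s + t) x)) = fun s => W s (S t (W t x)) := by
      refine eq_of_hasDerivAt_linear hK (fun s => ?_) (fun s => hW _ s) (by simp [hW0])
      have h2 := (hW x (s + t)).comp_add_const s t
      have h3 := ((S t).restrictScalars ℝ).hasFDerivAt.comp_hasDerivAt s h2
      have h4 : c s (S t (W (s + t) x)) = S t (c (s + t) (W (s + t) x)) := by
        have h5 (z : X) : S t (S (-(s + t)) z) = S (-s) z := by
          rw [← hS.add_apply, neg_add_rev, add_neg_cancel_left]
        simp only [hcdef, neg_apply, ContinuousLinearMap.comp_apply, map_neg, h5, hS.add_apply s t]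
      rw [h4]
      exact h3
    have := congrFun h1 s
    simp only [ContinuousLinearMap.comp_apply] at this ⊢
    rw [hS.add_apply, this]
  · have h1 : Tendsto (fun t : ℝ => S t (t⁻¹ • (W (0 + t) x - W 0 x))) (𝓝[≠] 0) (𝓝 (-C x)) := by
      have := hS.tendsto_apply (tendsto_nhdsWithin_of_tendsto_nhds (s := {0}ᶜ) (a := (0 : ℝ))
        tendsto_id) (hasDerivAt_iff_tendsto_slope_zero.1 (hW x 0))
      simpa [hcdef, hS.zero, hW0] using this
    have h2 (t : ℝ) : t⁻¹ • (S (0 + t) (W (0 + t) x) - S 0 (W 0 x)) =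
        S t (t⁻¹ • (W (0 + t) x - W 0 x)) + t⁻¹ • (S (0 + t) x - S 0 x) := by
      rw [← algebraMap_smul ℂ t⁻¹, ← algebraMap_smul ℂ t⁻¹ (W (0 + t) x - W 0 x),
        ← algebraMap_smul ℂ t⁻¹ (S (0 + t) x - S 0 x), map_smul, ← smul_add]
      simp [hS.zero, hW0]
    rw [hasDerivAt_iff_tendsto_slope_zero, hasDerivAt_iff_tendsto_slope_zero]
    simp only [ContinuousLinearMap.comp_apply, h2]
    constructor <;> intro h
    · simpa using h.sub h1
    · simpa using h1.add h

omit [CompleteSpace X] in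
/-- Transport of a strongly continuous group along an isomorphism. -/
theorem IsC0Group.conj {Y : Type*} [NormedAddCommGroup Y] [NormedSpace ℂ Y] [NormedSpace ℝ Y]
    [IsScalarTower ℝ ℂ Y] {S : ℝ → X →L[ℂ] X} (hS : IsC0Group S) (U : X ≃L[ℂ] Y) :
    IsC0Group (fun t => (U : X →L[ℂ] Y).comp ((S t).comp (U.symm : Y →L[ℂ] X))) ∧
      ∀ x y, HasDerivAt (fun t => (U : X →L[ℂ] Y).comp ((S t).comp (U.symm : Y →L[ℂ] X)) x) y 0 ↔
        HasDerivAt (fun t => S t (U.symm x)) (U.symm y) 0 := by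
  refine ⟨⟨?_, fun s t => ?_, fun x => ?_⟩, fun x y => ⟨fun h => ?_, fun h => ?_⟩⟩
  · ext x; simp [hS.zero]
  · ext x; simp [hS.add]
  · exact U.continuous.comp (hS.continuous _)
  · have := ((U.symm : Y →L[ℂ] X).restrictScalars ℝ).hasFDerivAt.comp_hasDerivAt 0 h
    simpa [Function.comp_def] using this
  · have := ((U : X →L[ℂ] Y).restrictScalars ℝ).hasFDerivAt.comp_hasDerivAt 0 h
    simpa [Function.comp_def] using this

end Perturbation

end GroupTheory

/-- The space `ℓ²(ℤ, H)`. -/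
abbrev Ell2 (H : Type*) [NormedAddCommGroup H] : Type _ := lp (fun _ : ℤ => H) 2

/-! ### Diagonal and square summable matrix operators on ℓ²(ℤ, H) -/

section SquareSummable

variable {ι : Type*}

theorem summable_mul_of_sq {f g : ι → ℝ} (hf : ∀ i, 0 ≤ f i) (hg : ∀ i, 0 ≤ g i)
    (hf2 : Summable fun i => f i ^ 2) (hg2 : Summable fun i => g i ^ 2) :
    Summable fun i => f i * g i :=
  Real.summable_mul_of_Lp_Lq_of_nonneg .two_two hf hg (by simpa using hf2) (by simpa using hg2)

theorem tsum_mul_le_sqrt {f g : ι → ℝ} (hf : ∀ i, 0 ≤ f i) (hg : ∀ i, 0 ≤ g i)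
    (hf2 : Summable fun i => f i ^ 2) (hg2 : Summable fun i => g i ^ 2) :
    ∑' i, f i * g i ≤ √(∑' i, f i ^ 2) * √(∑' i, g i ^ 2) := by
  simpa [Real.sqrt_eq_rpow] using
    Real.inner_le_Lp_mul_Lq_tsum_of_nonneg .two_two hf hg (by simpa using hf2) (by simpa using hg2)

end SquareSummable

section Operators

variable {H : Type*} [NormedAddCommGroup H]

theorem Ell2.summable_sq (x : Ell2 H) : Summable fun n => ‖x n‖ ^ 2 := by
  simpa using (lp.memℓp x).summable (by norm_num)

theorem Ell2.norm_sq (x : Ell2 H) : ‖x‖ ^ 2 = ∑' n, ‖x n‖ ^ 2 := by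
  simpa using lp.norm_rpow_eq_tsum (p := 2) (by norm_num) x

theorem Ell2.norm_eq (x : Ell2 H) : ‖x‖ = √(∑' n, ‖x n‖ ^ 2) := by
  rw [← x.norm_sq, Real.sqrt_sq (norm_nonneg x)]

/-- A square summable sequence as an element of `ℓ²(ℤ, H)`. -/
def Ell2.mk (f : ℤ → H) (hf : Summable fun n => ‖f n‖ ^ 2) : Ell2 H :=
  ⟨f, memℓp_gen (by simpa using hf)⟩

@[simp]
theorem Ell2.mk_apply (f : ℤ → H) (hf : Summable fun n => ‖f n‖ ^ 2) (n : ℤ) :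
    Ell2.mk f hf n = f n := rfl

theorem Ell2.summable_of_le {f : ℤ → H} {g : ℤ → ℝ} (h : ∀ n, ‖f n‖ ≤ g n)
    (hg : Summable fun n => g n ^ 2) : Summable fun n => ‖f n‖ ^ 2 :=
  .of_nonneg_of_le (fun _ => by positivity) (fun n => by gcongr; exact h n) hg

theorem Ell2.norm_le {x : Ell2 H} {g : ℤ → ℝ} (h : ∀ n, ‖x n‖ ≤ g n)
    (hg : Summable fun n => g n ^ 2) : ‖x‖ ≤ √(∑' n, g n ^ 2) := by
  rw [Ell2.norm_eq]
  exact Real.sqrt_le_sqrt (x.summable_sq.tsum_le_tsum (fun n => by gcongr; exact h n) hg)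

variable [InnerProductSpace ℂ H]

/-- Evaluation at `n` on `ℓ²(ℤ, H)`. -/
def Ell2.eval (n : ℤ) : Ell2 H →L[ℂ] H :=
  LinearMap.mkContinuous
    { toFun := fun x => x n
      map_add' := fun _ _ => rfl
      map_smul' := fun _ _ => rfl } 1 fun x => by
    rw [one_mul]
    exact lp.norm_apply_le_norm two_ne_zero x n

@[simp]
theorem Ell2.eval_apply (n : ℤ) (x : Ell2 H) : Ell2.eval n x = x n := rfl

/-- The diagonal operator with bounded entries `d n`. -/
def diagOp (d : ℤ → H →L[ℂ] H) {K : ℝ} (hd : ∀ n, ‖d n‖ ≤ K) : Ell2 H →L[ℂ] Ell2 H :=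
  have h (x : Ell2 H) (n : ℤ) : ‖d n (x n)‖ ≤ K * ‖x n‖ := (d n).le_of_opNorm_le (hd n) _
  have hs (x : Ell2 H) : Summable fun n => (K * ‖x n‖) ^ 2 := by
    simpa only [mul_pow] using x.summable_sq.mul_left (K ^ 2)
  LinearMap.mkContinuous
    { toFun := fun x => Ell2.mk (fun n => d n (x n)) (Ell2.summable_of_le (h x) (hs x))
      map_add' := fun x y => by ext n; simp
      map_smul' := fun c x => by ext n; simp } K fun x => by
    have hK : 0 ≤ K := (norm_nonneg _).trans (hd 0)
    refine (Ell2.norm_le (h x) (hs x)).trans_eq ?_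
    simp only [mul_pow]
    rw [tsum_mul_left, ← x.norm_sq, ← mul_pow, Real.sqrt_sq (by positivity)]

@[simp]
theorem diagOp_apply (d : ℤ → H →L[ℂ] H) {K : ℝ} (hd : ∀ n, ‖d n‖ ≤ K) (x : Ell2 H) (n : ℤ) :
    diagOp d hd x n = d n (x n) := rfl

theorem norm_diagOp_le (d : ℤ → H →L[ℂ] H) {K : ℝ} (hd : ∀ n, ‖d n‖ ≤ K) : ‖diagOp d hd‖ ≤ K := by
  unfold diagOp
  exact LinearMap.mkContinuous_norm_le _ ((norm_nonneg _).trans (hd 0)) _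

section Rows

variable {r : ℤ → H →L[ℂ] H} (hr : Summable fun m => ‖r m‖ ^ 2)

include hr in
theorem summable_norm_mul_row (x : Ell2 H) : Summable fun m => ‖r m‖ * ‖x m‖ :=
  summable_mul_of_sq (fun _ => norm_nonneg _) (fun _ => norm_nonneg _) hr x.summable_sq

variable [CompleteSpace H]

include hr in
theorem summable_row (x : Ell2 H) : Summable fun m => r m (x m) :=
  .of_norm_bounded (summable_norm_mul_row hr x) fun m => (r m).le_opNorm _

omit [CompleteSpace H] in
include hr in
theorem norm_tsum_row_le (x : Ell2 H) : ‖∑' m, r m (x m)‖ ≤ √(∑' m, ‖r m‖ ^ 2) * ‖x‖ := by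
  rw [x.norm_eq]
  exact (tsum_of_norm_bounded (summable_norm_mul_row hr x).hasSum fun m => (r m).le_opNorm _).trans
    (tsum_mul_le_sqrt (fun _ => norm_nonneg _) (fun _ => norm_nonneg _) hr x.summable_sq)

end Rows

variable [CompleteSpace H]

/-- The operator on `ℓ²(ℤ, H)` with a square summable matrix. -/
def matrixOp (M : ℤ → ℤ → H →L[ℂ] H) (hM : Summable fun p : ℤ × ℤ => ‖M p.1 p.2‖ ^ 2) :
    Ell2 H →L[ℂ] Ell2 H :=
  have hrow (n : ℤ) : Summable fun m => ‖M n m‖ ^ 2 := hM.prod_factor n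
  have hs (x : Ell2 H) : Summable fun n => (√(∑' m, ‖M n m‖ ^ 2) * ‖x‖) ^ 2 := by
    simp_rw [mul_pow, Real.sq_sqrt (tsum_nonneg fun _ => sq_nonneg _)]
    exact hM.prod.mul_right _
  LinearMap.mkContinuous
    { toFun := fun x => Ell2.mk (fun n => ∑' m, M n m (x m))
        (Ell2.summable_of_le (fun n => norm_tsum_row_le (hrow n) x) (hs x))
      map_add' := fun x y => by
        ext n
        simpa using (summable_row (hrow n) x).tsum_add (summable_row (hrow n) y)
      map_smul' := fun c x => by
        ext n
        simpa using (summable_row (hrow n) x).tsum_const_smul c }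
    (√(∑' p : ℤ × ℤ, ‖M p.1 p.2‖ ^ 2)) fun x => by
    refine (Ell2.norm_le (fun n => norm_tsum_row_le (hrow n) x) (hs x)).trans_eq ?_
    simp_rw [mul_pow, Real.sq_sqrt (tsum_nonneg fun _ => sq_nonneg _)]
    rw [tsum_mul_right, ← hM.tsum_prod, Real.sqrt_mul (tsum_nonneg fun _ => sq_nonneg _),
      Real.sqrt_sq (norm_nonneg x)]

@[simp]
theorem matrixOp_apply (M : ℤ → ℤ → H →L[ℂ] H) (hM : Summable fun p : ℤ × ℤ => ‖M p.1 p.2‖ ^ 2)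
    (x : Ell2 H) (n : ℤ) : matrixOp M hM x n = ∑' m, M n m (x m) := rfl

theorem norm_matrixOp_le (M : ℤ → ℤ → H →L[ℂ] H)
    (hM : Summable fun p : ℤ × ℤ => ‖M p.1 p.2‖ ^ 2) :
    ‖matrixOp M hM‖ ≤ √(∑' p : ℤ × ℤ, ‖M p.1 p.2‖ ^ 2) := by
  unfold matrixOp
  exact LinearMap.mkContinuous_norm_le _ (Real.sqrt_nonneg _) _

end Operators

/-! ### The unperturbed diagonal group -/

section Rotation

variable {H : Type*} [NormedAddCommGroup H] [InnerProductSpace ℂ H]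

theorem norm_exp_smul_id_le (θ t : ℝ) (n : ℤ) :
    ‖Complex.exp (Complex.I * θ * n * t) • ContinuousLinearMap.id ℂ H‖ ≤ 1 := by
  rw [norm_smul, show Complex.I * θ * n * t = ((θ * n * t : ℝ) : ℂ) * Complex.I by push_cast; ring,
    Complex.norm_exp_ofReal_mul_I, one_mul]
  exact ContinuousLinearMap.norm_id_le

/-- The diagonal group `(S(t) x)(n) = exp (i θ n t) x(n)`. -/
def rotation (θ t : ℝ) : Ell2 H →L[ℂ] Ell2 H :=
  diagOp (fun n => Complex.exp (Complex.I * θ * n * t) • ContinuousLinearMap.id ℂ H)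
    (norm_exp_smul_id_le θ t)

@[simp]
theorem rotation_apply (θ t : ℝ) (x : Ell2 H) (n : ℤ) :
    rotation θ t x n = Complex.exp (Complex.I * θ * n * t) • x n := rfl

theorem norm_rotation_le (θ t : ℝ) : ‖rotation (H := H) θ t‖ ≤ 1 := norm_diagOp_le _ _

theorem isC0Group_rotation (θ : ℝ) : IsC0Group (rotation (H := H) θ) where
  zero := by ext x n; simp
  add s t := by
    ext x n
    simp [smul_smul, ← Complex.exp_add, mul_add]
  continuous x := by
    refine continuous_iff_continuousAt.2 fun t₀ => ?_
    rw [ContinuousAt, tendsto_iff_norm_sub_tendsto_zero]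
    have h : Tendsto (fun t => ‖rotation θ t x - rotation θ t₀ x‖ ^ 2) (𝓝 t₀) (𝓝 0) := by
      simp_rw [Ell2.norm_sq]
      rw [← tsum_zero (β := ℤ)]
      refine tendsto_tsum_of_dominated_convergence (bound := fun n => (2 * ‖x n‖) ^ 2) ?_ ?_ ?_
      · simpa only [mul_pow] using x.summable_sq.mul_left (2 ^ 2)
      · intro n
        have : Continuous fun t : ℝ => ‖Complex.exp (Complex.I * θ * n * t) • x n -
            Complex.exp (Complex.I * θ * n * t₀) • x n‖ ^ 2 := by fun_prop
        simpa using this.tendsto t₀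
      · refine Eventually.of_forall fun t n => ?_
        rw [Real.norm_of_nonneg (sq_nonneg _)]
        gcongr
        have h1 (t : ℝ) : ‖rotation θ t x n‖ ≤ ‖x n‖ := by
          simpa using ContinuousLinearMap.le_of_opNorm_le _ (norm_exp_smul_id_le θ t n) (x n)
        calc ‖(rotation θ t x - rotation θ t₀ x) n‖ ≤ ‖rotation θ t x n‖ + ‖rotation θ t₀ x n‖ :=
              norm_sub_le _ _
          _ ≤ 2 * ‖x n‖ := by linarith [h1 t, h1 t₀]
    simpa using h.sqrt

theorem hasDerivAt_exp_smul (θ : ℝ) (n : ℤ) (x : H) (t : ℝ) :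
    HasDerivAt (fun t : ℝ => Complex.exp (Complex.I * θ * n * t) • x)
      (Complex.exp (Complex.I * θ * n * t) • (Complex.I * θ * n) • x) t := by
  have h1 : HasDerivAt (fun t : ℝ => Complex.I * θ * n * (t : ℂ)) (Complex.I * θ * n) t := by
    simpa using (HasDerivAt.ofReal_comp (hasDerivAt_id t)).const_mul (Complex.I * θ * n)
  rw [smul_smul]
  exact h1.cexp.smul_const x

/-- The generator has the maximal domain: integrating each coordinate gives S(t)x = x + ∫₀ᵗ S(s)y,
and the right side is differentiable in the ℓ² norm, not merely coordinatewise. -/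
theorem hasDerivAt_rotation_iff [CompleteSpace H] (θ : ℝ) (x y : Ell2 H) :
    HasDerivAt (fun t => rotation θ t x) y 0 ↔ ∀ n : ℤ, y n = (Complex.I * θ * n) • x n := by
  constructor
  · intro h n
    have h1 := ((Ell2.eval n).restrictScalars ℝ).hasFDerivAt.comp_hasDerivAt 0 h
    have h2 := hasDerivAt_exp_smul θ n (x n) 0
    simpa using HasDerivAt.unique (f := fun t : ℝ => Complex.exp (Complex.I * θ * n * t) • x n) h1 h2
  · intro h
    have hc := (isC0Group_rotation θ).continuous y
    have hx (t : ℝ) : rotation θ t x = x + ∫ s in (0 : ℝ)..t, rotation θ s y := by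
      ext n
      have h1 := (Ell2.eval n).intervalIntegral_comp_comm (hc.intervalIntegrable (μ := volume) 0 t)
      have h2 := intervalIntegral.integral_eq_sub_of_hasDerivAt
        (fun t _ => hasDerivAt_exp_smul θ n (x n) t)
        (Continuous.intervalIntegrable (by fun_prop) 0 t)
      simp only [Ell2.eval_apply, rotation_apply, h] at h1
      rw [lp.coeFn_add, Pi.add_apply, ← h1, h2]
      simp
    have hd := intervalIntegral.integral_hasDerivAt_right (hc.intervalIntegrable 0 0)
      (hc.stronglyMeasurableAtFilter volume (𝓝 0)) hc.continuousAt
    rw [(isC0Group_rotation θ).zero_apply] at hd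
    exact (hd.const_add x).congr_of_eventuallyEq (Eventually.of_forall hx)

end Rotation

/-! ### The Hankel matrix, its divided matrix, and resolvent bounds -/

section Hankel

variable {H : Type*} [NormedAddCommGroup H] [InnerProductSpace ℂ H]

/-- The graph, in Fourier coordinates, of `y ↦ y' - V y(ω - ·)`; here `θ = 2π/ω`, and the
potential acts by the Hankel matrix of its Fourier coefficients `a`. -/
def HankelGraph (θ : ℝ) (a : ℤ → H →L[ℂ] H) (x z : Ell2 H) : Prop :=
  ∃ w : Ell2 H, (∀ n : ℤ, w n = (Complex.I * θ * n) • x n) ∧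
    ∀ n, z n = w n - ∑' m, a (n + m) (x m)

/-- The matrix with entries `a(n + m) / (iθ(n - m))` off the diagonal and `0` on it. -/
def divMatrix (θ : ℝ) (a : ℤ → H →L[ℂ] H) (n m : ℤ) : H →L[ℂ] H :=
  (Complex.I * θ * (n - m))⁻¹ • a (n + m)

/-- The matrix `M` with the columns in `s` removed. -/
def dropColumns (s : Finset ℤ) (M : ℤ → ℤ → H →L[ℂ] H) (n m : ℤ) : H →L[ℂ] H :=
  if m ∈ s then 0 else M n m

theorem norm_dropColumns_le (s : Finset ℤ) (M : ℤ → ℤ → H →L[ℂ] H) (n m : ℤ) :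
    ‖dropColumns s M n m‖ ≤ ‖M n m‖ := by
  unfold dropColumns
  split_ifs <;> simp

theorem summable_dropColumns (s : Finset ℤ) {M : ℤ → ℤ → H →L[ℂ] H}
    (hM : Summable fun p : ℤ × ℤ => ‖M p.1 p.2‖ ^ 2) :
    Summable fun p : ℤ × ℤ => ‖dropColumns s M p.1 p.2‖ ^ 2 :=
  .of_nonneg_of_le (fun _ => by positivity)
    (fun p => by gcongr; exact norm_dropColumns_le s M p.1 p.2) hM

/-- Finitely many entries carry all but ε of the sum; every column meeting them is removed. Whole
columns are removed so that the product BΓ loses only the corresponding columns. -/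
theorem exists_tsum_dropColumns_lt {M : ℤ → ℤ → H →L[ℂ] H}
    (hM : Summable fun p : ℤ × ℤ => ‖M p.1 p.2‖ ^ 2) {ε : ℝ} (hε : 0 < ε) :
    ∃ s : Finset ℤ, ∑' p : ℤ × ℤ, ‖dropColumns s M p.1 p.2‖ ^ 2 < ε := by
  obtain ⟨F, hF⟩ := ((tendsto_order.1 (tendsto_tsum_compl_atTop_zero
    fun p : ℤ × ℤ => ‖M p.1 p.2‖ ^ 2)).2 ε hε).exists
  refine ⟨F.image Prod.snd, lt_of_le_of_lt ?_ hF⟩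
  refine le_of_le_of_eq ?_
    (tsum_subtype {p : ℤ × ℤ | p ∉ F} fun p : ℤ × ℤ => ‖M p.1 p.2‖ ^ 2).symm
  refine (summable_dropColumns _ hM).tsum_le_tsum (fun p => ?_) (hM.indicator _)
  by_cases hp : p ∈ F
  · have : p.2 ∈ F.image Prod.snd := Finset.mem_image_of_mem _ hp
    simp [dropColumns, this, hp]
  · rw [indicator_of_mem (by exact hp)]
    gcongr
    exact norm_dropColumns_le _ M p.1 p.2

variable {θ : ℝ} {a : ℤ → H →L[ℂ] H} (ha : Summable fun n => ‖a n‖ ^ 2)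

include ha in
theorem summable_hankel_row (n : ℤ) : Summable fun m => ‖a (n + m)‖ ^ 2 :=
  ha.comp_injective (add_right_injective n)

theorem tsum_hankel_col (a : ℤ → H →L[ℂ] H) (m : ℤ) :
    ∑' n, ‖a (n + m)‖ ^ 2 = ∑' n, ‖a n‖ ^ 2 :=
  (Equiv.addRight m).tsum_eq fun n => ‖a n‖ ^ 2

include ha in
theorem summable_hankel_col (m : ℤ) : Summable fun n => ‖a (n + m)‖ ^ 2 :=
  ha.comp_injective (add_left_injective m)

theorem norm_divMatrix (θ : ℝ) (a : ℤ → H →L[ℂ] H) (n m : ℤ) :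
    ‖divMatrix θ a n m‖ = |θ|⁻¹ * |((n - m : ℤ) : ℝ)|⁻¹ * ‖a (n + m)‖ := by
  have : ((n : ℂ) - m) = ((n - m : ℤ) : ℝ) := by push_cast; ring
  simp only [divMatrix, norm_smul, this, norm_inv, norm_mul, Complex.norm_I, Complex.norm_real,
    Real.norm_eq_abs, mul_inv, inv_one, one_mul]

include ha in
-- In the injective coordinates (n + m, n - m) the entries factor into ‖a‖² times an inverse square.
-- The convention 0⁻¹ = 0 takes care of the diagonal.
theorem summable_divMatrix (θ : ℝ) :
    Summable fun p : ℤ × ℤ => ‖divMatrix θ a p.1 p.2‖ ^ 2 := by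
  have h1 : Summable fun d : ℤ => (|(d : ℝ)|⁻¹) ^ 2 := by
    simpa using Real.summable_one_div_int_pow.2 one_lt_two
  have h2 := (ha.mul_of_nonneg h1 (fun _ => sq_nonneg _) fun _ => sq_nonneg _).mul_left (|θ|⁻¹ ^ 2)
  have hinj : Function.Injective fun p : ℤ × ℤ => (p.1 + p.2, p.1 - p.2) := by
    rintro ⟨n, m⟩ ⟨n', m'⟩ h
    simp only [Prod.mk.injEq] at h ⊢
    omega
  refine (h2.comp_injective hinj).congr fun p => ?_
  simp only [Function.comp_apply, norm_divMatrix]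
  ring

include ha in
/-- Finitely many columns of the Hankel matrix form a square summable matrix. -/
theorem summable_hankel_columns (s : Finset ℤ) :
    Summable fun p : ℤ × ℤ => ‖if p.2 ∈ s then a (p.1 + p.2) else 0‖ ^ 2 := by
  have h1 : Summable fun m : ℤ => if m ∈ s then (1 : ℝ) else 0 :=
    summable_of_ne_finset_zero (s := s) fun m hm => by simp [hm]
  have h2 := ha.mul_of_nonneg h1 (fun _ => sq_nonneg _) fun _ => by positivity
  have hinj : Function.Injective fun p : ℤ × ℤ => (p.1 + p.2, p.2) := by
    rintro ⟨n, m⟩ ⟨n', m'⟩ h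
    simp only [Prod.mk.injEq] at h ⊢
    omega
  refine (h2.comp_injective hinj).congr fun p => ?_
  by_cases hp : p.2 ∈ s <;> simp [hp]

include ha in
theorem norm_le_sqrt_tsum_sq (n : ℤ) : ‖a n‖ ≤ √(∑' n, ‖a n‖ ^ 2) :=
  Real.le_sqrt_of_sq_le (ha.le_tsum n fun _ _ => sq_nonneg _)

include ha in
theorem norm_hankel_col_le {x : Ell2 H} {m : ℤ} {h : H} (hx : ∀ n, x n = a (n + m) h) :
    ‖x‖ ≤ √(∑' n, ‖a n‖ ^ 2) * ‖h‖ := by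
  have hle (n : ℤ) : ‖x n‖ ≤ ‖a (n + m)‖ * ‖h‖ := hx n ▸ (a (n + m)).le_opNorm _
  have hs : Summable fun n => (‖a (n + m)‖ * ‖h‖) ^ 2 := by
    simpa only [mul_pow] using (summable_hankel_col ha m).mul_right (‖h‖ ^ 2)
  refine (Ell2.norm_le hle hs).trans_eq ?_
  simp only [mul_pow]
  rw [tsum_mul_right, tsum_hankel_col, Real.sqrt_mul (tsum_nonneg fun _ => sq_nonneg _),
    Real.sqrt_sq (norm_nonneg _)]

variable [CompleteSpace H]

include ha in
/-- The Hankel operator is defined on summable sequences. -/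
theorem exists_hankel_apply {x : ℤ → H} (hx : Summable fun m => ‖x m‖) :
    ∃ b : Ell2 H, (∀ n, b n = ∑' m, a (n + m) (x m)) ∧
      ‖b‖ ≤ √(∑' n, ‖a n‖ ^ 2) * ∑' m, ‖x m‖ := by
  have hle (m n : ℤ) : ‖a (n + m) (x m)‖ ≤ ‖a (n + m)‖ * ‖x m‖ := (a (n + m)).le_opNorm _
  have hs (m : ℤ) : Summable fun n => (‖a (n + m)‖ * ‖x m‖) ^ 2 := by
    simpa only [mul_pow] using (summable_hankel_col ha m).mul_right (‖x m‖ ^ 2)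
  -- The sum is taken over columns: column m is a shift of the ℓ² sequence a applied to x(m), so the
  -- columns converge absolutely in ℓ².
  set col : ℤ → Ell2 H := fun m => Ell2.mk (fun n => a (n + m) (x m))
    (Ell2.summable_of_le (hle m) (hs m)) with hcol
  have hcoln (m : ℤ) : ‖col m‖ ≤ √(∑' n, ‖a n‖ ^ 2) * ‖x m‖ := norm_hankel_col_le ha fun _ => rfl
  have hsum := hx.mul_left (√(∑' n, ‖a n‖ ^ 2))
  refine ⟨∑' m, col m, fun n => ?_, ?_⟩
  · exact (Ell2.eval n).map_tsum (Summable.of_norm_bounded hsum hcoln)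
  · rw [← tsum_mul_left]
    exact tsum_of_norm_bounded hsum.hasSum hcoln

section Resolvent

theorem norm_resolvent_sq (θ lam : ℝ) (n : ℤ) :
    ‖((lam : ℂ) - Complex.I * θ * n)⁻¹‖ ^ 2 = (lam ^ 2 + θ ^ 2 * n ^ 2)⁻¹ := by
  rw [norm_inv, inv_pow, ← Complex.normSq_eq_norm_sq, Complex.normSq_apply]
  simp
  ring

theorem sub_I_mul_ne_zero {lam : ℝ} (hl : 0 < lam) (θ : ℝ) (n : ℤ) :
    (lam : ℂ) - Complex.I * θ * n ≠ 0 := fun h => by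
  have := congrArg Complex.re h
  simp at this
  exact hl.ne' this

theorem norm_resolvent_le {lam : ℝ} (hl : 0 < lam) (θ : ℝ) (n : ℤ) :
    ‖((lam : ℂ) - Complex.I * θ * n)⁻¹‖ ≤ lam⁻¹ := by
  refine (sq_le_sq₀ (norm_nonneg _) (by positivity)).1 ?_
  rw [norm_resolvent_sq, inv_pow]
  gcongr
  nlinarith [sq_nonneg (θ * n)]

theorem summable_resolvent {θ lam : ℝ} (hθ : θ ≠ 0) :
    Summable fun n : ℤ => ‖((lam : ℂ) - Complex.I * θ * n)⁻¹‖ ^ 2 := by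
  have h1 : Summable fun n : ℤ => (θ ^ 2)⁻¹ * (1 / (n : ℝ) ^ 2) :=
    (Real.summable_one_div_int_pow.2 one_lt_two).mul_left _
  refine Summable.of_norm_bounded_eventually h1 ?_
  have : ({0}ᶜ : Set ℤ) ∈ cofinite := (finite_singleton 0).compl_mem_cofinite
  filter_upwards [this] with n hn
  have hn' : (n : ℝ) ≠ 0 := by exact_mod_cast hn
  rw [norm_resolvent_sq, Real.norm_of_nonneg (by positivity), one_div, ← mul_inv]
  gcongr
  nlinarith [sq_nonneg lam]

theorem tendsto_tsum_resolvent {θ : ℝ} (hθ : θ ≠ 0) :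
    Tendsto (fun lam : ℝ => ∑' n : ℤ, ‖((lam : ℂ) - Complex.I * θ * n)⁻¹‖ ^ 2) atTop (𝓝 0) := by
  rw [← tsum_zero (β := ℤ)]
  refine tendsto_tsum_of_dominated_convergence (summable_resolvent (lam := 1) hθ) (fun n => ?_) ?_
  · refine squeeze_zero' (g := fun lam : ℝ => (lam⁻¹) ^ 2) (Eventually.of_forall fun _ => sq_nonneg _)
      ?_ (by simpa using (tendsto_inv_atTop_zero (𝕜 := ℝ)).pow 2)
    filter_upwards [eventually_gt_atTop 0] with lam hl
    gcongr
    exact norm_resolvent_le hl θ n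
  · filter_upwards [eventually_ge_atTop 1] with lam hl n
    rw [Real.norm_of_nonneg (sq_nonneg _), norm_resolvent_sq, norm_resolvent_sq]
    gcongr

omit [CompleteSpace H] in
-- Write x = (λ - A)⁻¹(λx - w) and apply Cauchy–Schwarz to the ℓ² sequence of resolvent entries. The
-- constant tends to 0 as λ → ∞, which the injectivity argument exploits.
theorem summable_norm_of_domain {lam : ℝ} (hl : 0 < lam) (hθ : θ ≠ 0) {x w : Ell2 H}
    (hw : ∀ n : ℤ, w n = (Complex.I * θ * n) • x n) :
    Summable (fun n => ‖x n‖) ∧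
      ∑' n, ‖x n‖ ≤ √(∑' n : ℤ, ‖((lam : ℂ) - Complex.I * θ * n)⁻¹‖ ^ 2) * ‖(lam : ℂ) • x - w‖ := by
  have hx (n : ℤ) : ‖x n‖ =
      ‖((lam : ℂ) - Complex.I * θ * n)⁻¹‖ * ‖((lam : ℂ) • x - w) n‖ := by
    rw [← norm_smul]
    congr 1
    have : ((lam : ℂ) • x - w) n = ((lam : ℂ) - Complex.I * θ * n) • x n := by
      rw [lp.coeFn_sub, Pi.sub_apply, hw, sub_smul]
      rfl
    rw [this, inv_smul_smul₀ (sub_I_mul_ne_zero hl θ n)]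
  simp_rw [hx]
  have h1 := summable_resolvent (lam := lam) hθ
  have h2 := ((lam : ℂ) • x - w).summable_sq
  refine ⟨summable_mul_of_sq (fun _ => norm_nonneg _) (fun _ => norm_nonneg _) h1 h2, ?_⟩
  rw [((lam : ℂ) • x - w).norm_eq]
  exact tsum_mul_le_sqrt (fun _ => norm_nonneg _) (fun _ => norm_nonneg _) h1 h2

end Resolvent

theorem HankelGraph.sub {x z x' z' : Ell2 H} (ha : Summable fun n => ‖a n‖ ^ 2)
    (h : HankelGraph θ a x z) (h' : HankelGraph θ a x' z') :
    HankelGraph θ a (x - x') (z - z') := by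
  obtain ⟨w, hw, hz⟩ := h
  obtain ⟨w', hw', hz'⟩ := h'
  refine ⟨w - w', fun n => by simp [hw, hw', smul_sub], fun n => ?_⟩
  have := (summable_row (summable_hankel_row ha n) x).tsum_sub
    (summable_row (summable_hankel_row ha n) x')
  simp only [lp.coeFn_sub, Pi.sub_apply, map_sub, hz, hz', this]
  abel

/-- `λ - L` is injective for large `λ`. -/
theorem HankelGraph.eq_zero (ha : Summable fun n => ‖a n‖ ^ 2) (hθ : θ ≠ 0) {lam : ℝ}
    (hl : 0 < lam) (hsmall : √(∑' n : ℤ, ‖((lam : ℂ) - Complex.I * θ * n)⁻¹‖ ^ 2) *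
      √(∑' n, ‖a n‖ ^ 2) < 1) {x : Ell2 H} (h : HankelGraph θ a x ((lam : ℂ) • x)) : x = 0 := by
  obtain ⟨w, hw, hz⟩ := h
  obtain ⟨hs, hle⟩ := summable_norm_of_domain hl hθ hw
  obtain ⟨b, hb, hbn⟩ := exists_hankel_apply ha hs
  have hwb : (lam : ℂ) • x - w = -b := by
    ext n
    rw [lp.coeFn_sub, Pi.sub_apply, hz, ← hb]
    simp
  rw [hwb, norm_neg] at hle
  have hnn : 0 ≤ ∑' n, ‖x n‖ := tsum_nonneg fun _ => norm_nonneg _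
  -- The map x ↦ -(λ - A)⁻¹Bx is a strict contraction in the ℓ¹ norm, and x is fixed by it.
  have h0 : ∑' n, ‖x n‖ = 0 := by
    have : ∑' n, ‖x n‖ ≤ (√(∑' n : ℤ, ‖((lam : ℂ) - Complex.I * θ * n)⁻¹‖ ^ 2) *
        √(∑' n, ‖a n‖ ^ 2)) * ∑' n, ‖x n‖ := by
      rw [mul_assoc]
      exact hle.trans (by gcongr)
    nlinarith
  ext n
  exact norm_eq_zero.1 (congrFun
    ((hasSum_zero_iff_of_nonneg fun n => norm_nonneg (x n)).1 (h0 ▸ hs.hasSum)) n)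

end Hankel

/-! ### Similarity to a bounded perturbation of the diagonal operator -/

section Similarity

variable {H : Type*} [NormedAddCommGroup H] [InnerProductSpace ℂ H] [CompleteSpace H]
  {θ : ℝ} {a : ℤ → H →L[ℂ] H}

/-- The commutator identity: `iθn` times the divided Hankel matrix is the Hankel matrix, up to a
bounded diagonal and finitely many columns, plus the divided Hankel matrix applied to `w = Ax`. -/
theorem mul_tsum_dropColumns_divMatrix (ha : Summable fun n => ‖a n‖ ^ 2) (hθ : θ ≠ 0)
    (s : Finset ℤ) {x w : Ell2 H} (hw : ∀ n : ℤ, w n = (Complex.I * θ * n) • x n) (n : ℤ) :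
    (Complex.I * θ * n) • ∑' m, dropColumns s (divMatrix θ a) n m (x m) =
      ∑' m, a (n + m) (x m) - ∑' m, (if m ∈ s then a (n + m) else 0) (x m) -
        (if n ∈ s then 0 else a (n + n)) (x n) +
        ∑' m, dropColumns s (divMatrix θ a) n m (w m) := by
  have hD : Summable fun m => ‖dropColumns s (divMatrix θ a) n m‖ ^ 2 :=
    (summable_dropColumns s (summable_divMatrix ha θ)).prod_factor n
  have hB := summable_row (summable_hankel_row ha n) x
  have hK : Summable fun m => (if m ∈ s then a (n + m) else 0) (x m) :=
    summable_row ((summable_hankel_columns ha s).prod_factor n) x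
  -- The diagonal correction is written as a sum over m supported at m = n, so that the identity can
  -- be checked term by term.
  have hd : HasSum (fun m => if m = n then (if n ∈ s then 0 else a (n + n)) (x n) else 0)
      ((if n ∈ s then 0 else a (n + n)) (x n)) := hasSum_ite_eq n _
  rw [← (summable_row hD x).tsum_const_smul, ← hB.tsum_sub hK, ← hd.tsum_eq,
    ← (hB.sub hK).tsum_sub hd.summable,
    ← ((hB.sub hK).sub hd.summable).tsum_add (summable_row hD w)]
  refine tsum_congr fun m => ?_
  by_cases hms : m ∈ s
  · have : (if m = n then (if n ∈ s then 0 else a (n + n)) (x n) else 0) = 0 := by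
      split_ifs with h1 h2
      · simp
      · exact absurd (h1 ▸ hms) h2
      · rfl
    rw [this]
    simp [dropColumns, hms]
  · by_cases hmn : m = n
    · subst hmn
      simp [dropColumns, hms, divMatrix]
    · have hne : (n : ℂ) - m ≠ 0 := sub_ne_zero.2 fun h => hmn (by exact_mod_cast h.symm)
      have hθ' : (θ : ℂ) ≠ 0 := by exact_mod_cast hθ
      simp only [dropColumns, hms, divMatrix, hmn, if_false, hw, map_smul, smul_apply, zero_apply,
        sub_zero, smul_smul]
      -- Off the diagonal the identity is (iθn - iθm)/(iθ(n - m)) = 1.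
      rw [← sub_eq_iff_eq_add, ← sub_smul]
      convert one_smul ℂ _ using 2
      field_simp

/-- Interchange of summations in the product of the Hankel matrix and a square summable matrix. -/
theorem tsum_hankel_matrixOp (ha : Summable fun n => ‖a n‖ ^ 2) {M : ℤ → ℤ → H →L[ℂ] H}
    (hM : Summable fun p : ℤ × ℤ => ‖M p.1 p.2‖ ^ 2) (x : Ell2 H) (n : ℤ) :
    ∑' m, a (n + m) (∑' k, M m k (x k)) = ∑' k, (∑' m, (a (n + m)).comp (M m k)) (x k) := by
  have hrow (m : ℤ) : Summable fun k => ‖M m k‖ ^ 2 := hM.prod_factor m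
  have hcol (k : ℤ) : Summable fun m => ‖M m k‖ ^ 2 :=
    hM.comp_injective (i := fun m : ℤ => (m, k)) fun m m' h => (Prod.mk.inj h).1
  have hn := summable_hankel_row ha n
  have h2 : Summable fun p : ℤ × ℤ => a (n + p.1) (M p.1 p.2 (x p.2)) := by
    -- For absolute convergence of the double sum, Cauchy–Schwarz on ℤ × ℤ pairs ‖a(n + m)‖‖x(k)‖
    -- with ‖M m k‖.
    have hx : Summable fun p : ℤ × ℤ => (‖a (n + p.1)‖ * ‖x p.2‖) ^ 2 := by
      simpa only [mul_pow] using
        hn.mul_of_nonneg x.summable_sq (fun _ => sq_nonneg _) fun _ => sq_nonneg _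
    refine Summable.of_norm_bounded (summable_mul_of_sq (fun _ => by positivity)
      (fun _ => norm_nonneg _) hx hM) fun p => ?_
    calc ‖a (n + p.1) (M p.1 p.2 (x p.2))‖ ≤ ‖a (n + p.1)‖ * (‖M p.1 p.2‖ * ‖x p.2‖) :=
          (a (n + p.1)).le_opNorm_of_le ((M p.1 p.2).le_opNorm _)
      _ = _ := by ring
  have h3 (k : ℤ) : Summable fun m => (a (n + m)).comp (M m k) :=
    .of_norm_bounded (summable_mul_of_sq (fun _ => norm_nonneg _) (fun _ => norm_nonneg _) hn
      (hcol k)) fun m => ContinuousLinearMap.opNorm_comp_le _ _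
  calc ∑' m, a (n + m) (∑' k, M m k (x k)) = ∑' m, ∑' k, a (n + m) (M m k (x k)) :=
        tsum_congr fun m => (a (n + m)).map_tsum (summable_row (hrow m) x)
    _ = ∑' k, ∑' m, a (n + m) (M m k (x k)) :=
        (Summable.tsum_comm (f := fun m k => a (n + m) (M m k (x k))) h2).symm
    _ = _ := tsum_congr fun k =>
        ((ContinuousLinearMap.apply ℂ H (x k)).map_tsum (h3 k)).symm

variable (hdbl : Summable fun p : ℤ × ℤ =>
      ‖∑' n : {n : ℤ // n ≠ p.2}, ((p.2 : ℂ) - ((n : ℤ) : ℂ))⁻¹ •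
        ((a (p.1 + n)).comp (a (p.2 + n)))‖ ^ 2)

omit [CompleteSpace H] in
-- This links BΓ to the double-sum hypothesis. The sign comes from k - m against m - k, and the term
-- m = k vanishes, so the sum may run over m ≠ k.
theorem tsum_hankel_comp_divMatrix (θ : ℝ) (a : ℤ → H →L[ℂ] H) (n k : ℤ) :
    ∑' m, (a (n + m)).comp (divMatrix θ a m k) =
      -(Complex.I * θ)⁻¹ • ∑' m : {m : ℤ // m ≠ k}, ((k : ℂ) - ((m : ℤ) : ℂ))⁻¹ •
        ((a (n + m)).comp (a (k + m))) := by
  have h1 (m : ℤ) : (a (n + m)).comp (divMatrix θ a m k) =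
      -(Complex.I * θ)⁻¹ • (((k : ℂ) - m)⁻¹ • ((a (n + m)).comp (a (k + m)))) := by
    rw [divMatrix, ContinuousLinearMap.comp_smul, smul_smul, add_comm m k]
    congr 1
    rw [← neg_sub (k : ℂ) m, mul_neg, inv_neg, mul_inv, neg_mul]
  simp_rw [h1]
  rw [tsum_const_smul'']
  congr 1
  refine (tsum_subtype_eq_of_support_subset (s := {m : ℤ | m ≠ k}) fun m hm => ?_).symm
  rintro rfl
  simp at hm

include hdbl in
-- Column k of the product depends only on column k of the divided matrix, so deletion either kills
-- a column of the product or leaves it unchanged.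
theorem summable_hankel_mul_divMatrix (s : Finset ℤ) :
    Summable fun p : ℤ × ℤ =>
      ‖∑' m, (a (p.1 + m)).comp (dropColumns s (divMatrix θ a) m p.2)‖ ^ 2 := by
  refine Summable.of_nonneg_of_le (fun _ => sq_nonneg _) (fun p => ?_)
    (hdbl.mul_left (‖-(Complex.I * θ)⁻¹‖ ^ 2))
  rw [← mul_pow, ← norm_smul, ← tsum_hankel_comp_divMatrix]
  by_cases hp : p.2 ∈ s
  · simp only [dropColumns, hp, if_true, ContinuousLinearMap.comp_zero, tsum_zero, norm_zero,
      zero_pow two_ne_zero]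
    positivity
  · simp [dropColumns, hp]

include hdbl in
/-- The operator is similar, through an isomorphism `U`, to a bounded perturbation of the diagonal
operator `A = diag(iθn)`. -/
theorem exists_similarity (ha : Summable fun n => ‖a n‖ ^ 2) (hθ : θ ≠ 0) :
    ∃ (U : Ell2 H ≃L[ℂ] Ell2 H) (C : Ell2 H →L[ℂ] Ell2 H), ∀ x w : Ell2 H,
      (∀ n : ℤ, w n = (Complex.I * θ * n) • x n) → HankelGraph θ a (U x) (U (w - C x)) := by
  have hΓ := summable_divMatrix ha θ
  obtain ⟨s, hs⟩ := exists_tsum_dropColumns_lt hΓ zero_lt_one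
  set Γ := matrixOp _ (summable_dropColumns s hΓ) with hΓdef
  have hΓ1 : ‖-Γ‖ < 1 := by
    rw [norm_neg]
    refine (norm_matrixOp_le _ _).trans_lt ?_
    rw [Real.sqrt_lt' one_pos, one_pow]
    exact hs
  set U : Ell2 H ≃L[ℂ] Ell2 H := ContinuousLinearEquiv.unitsEquiv ℂ _ (Units.oneSub (-Γ) hΓ1)
  have hU (x : Ell2 H) : U x = x + Γ x := by simp [U]
  set K₁ := matrixOp (fun n m => if m ∈ s then a (n + m) else 0) (summable_hankel_columns ha s)
    with hK₁
  have hd (n : ℤ) : ‖if n ∈ s then 0 else a (n + n)‖ ≤ √(∑' n, ‖a n‖ ^ 2) := by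
    split_ifs
    · simp
    · exact norm_le_sqrt_tsum_sq ha _
  set K₂ := diagOp (fun n => if n ∈ s then 0 else a (n + n)) hd with hK₂
  set G := matrixOp (fun n k => ∑' m, (a (n + m)).comp (dropColumns s (divMatrix θ a) m k))
    (summable_hankel_mul_divMatrix hdbl s) with hG
  -- With G = BΓ, expanding gives (A - B)(1 + Γ) = (1 + Γ)A - (K₁ + K₂ + G), which forces this C.
  refine ⟨U, (U.symm : Ell2 H →L[ℂ] Ell2 H).comp (K₁ + K₂ + G), fun x w hw => ?_⟩
  obtain ⟨b, hb, -⟩ := exists_hankel_apply ha (summable_norm_of_domain one_pos hθ hw).1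
  have hΓn (x : Ell2 H) (n : ℤ) : Γ x n = ∑' m, dropColumns s (divMatrix θ a) n m (x m) := rfl
  -- The witness is AUx = Ax + AΓx, with AΓx read off from the commutator identity and b = Bx.
  refine ⟨w + (b - K₁ x - K₂ x + Γ w), fun n => ?_, fun n => ?_⟩
  · have h1 : U x n = x n + Γ x n := by rw [hU]; rfl
    rw [h1, smul_add, ← hw, hΓn, mul_tsum_dropColumns_divMatrix ha hθ s hw, ← hb]
    rfl
  · have h1 : ∑' m, a (n + m) (U x m) = b n + G x n := by
      have h2 := (summable_row (summable_hankel_row ha n) x).tsum_add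
        (summable_row (summable_hankel_row ha n) (Γ x))
      rw [hb, hG, matrixOp_apply, ← tsum_hankel_matrixOp ha (summable_dropColumns s hΓ)]
      simp only [hU, lp.coeFn_add, Pi.add_apply, map_add]
      exact h2
    rw [h1, map_sub, ContinuousLinearMap.comp_apply, ContinuousLinearEquiv.coe_coe,
      ContinuousLinearEquiv.apply_symm_apply, hU]
    simp only [lp.coeFn_add, lp.coeFn_sub, Pi.add_apply, Pi.sub_apply, add_apply]
    abel

/-- The operator in Fourier coordinates is exactly the similarity transform of `A - C`. -/
theorem hankelGraph_iff (ha : Summable fun n => ‖a n‖ ^ 2) (hθ : θ ≠ 0)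
    {U : Ell2 H ≃L[ℂ] Ell2 H} {C : Ell2 H →L[ℂ] Ell2 H} (hUC : ∀ x w : Ell2 H,
      (∀ n : ℤ, w n = (Complex.I * θ * n) • x n) → HankelGraph θ a (U x) (U (w - C x)))
    (x z : Ell2 H) :
    HankelGraph θ a x z ↔
      ∀ n : ℤ, (U.symm z + C (U.symm x)) n = (Complex.I * θ * n) • U.symm x n := by
  constructor
  · intro h
    have h1 : Tendsto (fun lam : ℝ => √(∑' n : ℤ, ‖((lam : ℂ) - Complex.I * θ * n)⁻¹‖ ^ 2) *
        √(∑' n, ‖a n‖ ^ 2)) atTop (𝓝 0) := by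
      simpa using (tendsto_tsum_resolvent hθ).sqrt.mul_const (√(∑' n, ‖a n‖ ^ 2))
    have h2 : Tendsto (fun lam : ℝ => ‖C‖ * lam⁻¹) atTop (𝓝 0) := by
      simpa using tendsto_inv_atTop_zero.const_mul ‖C‖
    -- λ is taken so large that λ - A + B is injective and 1 + CR is invertible, R being the
    -- resolvent of A at λ.
    obtain ⟨lam, ⟨hl1, hl2⟩, hl⟩ := (((h1.eventually_lt_const one_pos).and
      (h2.eventually_lt_const one_pos)).and (eventually_gt_atTop 0)).exists
    have hR (n : ℤ) : ‖((lam : ℂ) - Complex.I * θ * n)⁻¹ • ContinuousLinearMap.id ℂ H‖ ≤ lam⁻¹ := by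
      rw [norm_smul]
      exact (mul_le_of_le_one_right (norm_nonneg _) ContinuousLinearMap.norm_id_le).trans
        (norm_resolvent_le hl θ n)
    set R := diagOp _ hR with hRdef
    have hCR : ‖-(C.comp R)‖ < 1 := by
      rw [norm_neg]
      refine (ContinuousLinearMap.opNorm_comp_le _ _).trans_lt (lt_of_le_of_lt ?_ hl2)
      gcongr
      exact norm_diagOp_le _ _
    set N : Ell2 H ≃L[ℂ] Ell2 H := ContinuousLinearEquiv.unitsEquiv ℂ _ (Units.oneSub _ hCR)
    have hN (x : Ell2 H) : N x = x + C (R x) := by simp [N]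
    -- Since (λ - A + C)R = 1 + CR, the vector Rr solves (λ - A + C)(Rr) = U⁻¹(λx - z). Thus U(Rr)
    -- and x have the same image under λ - A + B, and injectivity identifies them.
    set r := N.symm (U.symm ((lam : ℂ) • x - z))
    have hr : r + C (R r) = U.symm ((lam : ℂ) • x - z) := by
      rw [← hN, N.apply_symm_apply]
    set w₀ := (lam : ℂ) • R r - r with hw₀def
    have hw₀ (n : ℤ) : w₀ n = (Complex.I * θ * n) • R r n := by
      have h3 : ((lam : ℂ) - Complex.I * θ * n) • R r n = r n := by
        simp [hRdef, smul_inv_smul₀ (sub_I_mul_ne_zero hl θ n)]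
      have h4 : w₀ n = (lam : ℂ) • R r n - r n := rfl
      rw [h4, ← h3, sub_smul]
      abel
    have h5 : U ((lam : ℂ) • R r - (w₀ - C (R r))) = (lam : ℂ) • x - z := by
      have : (lam : ℂ) • R r - (w₀ - C (R r)) = r + C (R r) := by rw [hw₀def]; abel
      rw [this, hr, U.apply_symm_apply]
    have h6 := h.sub ha (hUC _ _ hw₀)
    have h7 : z - U (w₀ - C (R r)) = (lam : ℂ) • (x - U (R r)) := by
      rw [map_sub, map_smul] at h5
      rw [sub_eq_sub_iff_add_eq_add] at h5
      rw [smul_sub, sub_eq_sub_iff_add_eq_add, add_comm, h5]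
    rw [h7] at h6
    have hx : x = U (R r) := sub_eq_zero.1 (h6.eq_zero ha hθ hl hl1)
    have hz : z = U (w₀ - C (R r)) := by
      rw [← sub_eq_zero, h7, ← hx]
      simp
    intro n
    rw [hz, hx]
    simpa using hw₀ n
  · intro h
    simpa using hUC _ _ h

/-- The operator in Fourier coordinates generates a strongly continuous group. -/
theorem exists_group_hankelGraph (ha : Summable fun n => ‖a n‖ ^ 2) (hθ : θ ≠ 0)
    (hdbl : Summable fun p : ℤ × ℤ =>
      ‖∑' n : {n : ℤ // n ≠ p.2}, ((p.2 : ℂ) - ((n : ℤ) : ℂ))⁻¹ •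
        ((a (p.1 + n)).comp (a (p.2 + n)))‖ ^ 2) :
    ∃ T : ℝ → Ell2 H →L[ℂ] Ell2 H, IsC0Group T ∧ ∀ x z,
      HasDerivAt (fun t => T t x) z 0 ↔ HankelGraph θ a x z := by
  obtain ⟨U, C, hUC⟩ := exists_similarity hdbl ha hθ
  obtain ⟨T, hT, hTd⟩ := (isC0Group_rotation (H := H) θ).exists_sub (norm_rotation_le θ) C
  refine ⟨_, (hT.conj U).1, fun x z => ?_⟩
  rw [(hT.conj U).2, hTd, hasDerivAt_rotation_iff, hankelGraph_iff ha hθ hUC]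

end Similarity

/-! ### Exponentials and the normalized measure -/

section Exponentials

theorem expo_mul (ω : ℝ) (n m : ℤ) (s : ℝ) : expo ω n s * expo ω m s = expo ω (n + m) s := by
  rw [expo, expo, expo, ← Complex.exp_add]
  congr 1
  push_cast
  ring

@[simp]
theorem expo_zero_index (ω s : ℝ) : expo ω 0 s = 1 := by simp [expo]

@[simp]
theorem expo_apply_zero (ω : ℝ) (n : ℤ) : expo ω n 0 = 1 := by simp [expo]

/-- This sign change is why the potential acts by a Hankel matrix, with n + m, rather than by a
convolution. -/
theorem expo_sub {ω : ℝ} (hω : ω ≠ 0) (n : ℤ) (s : ℝ) : expo ω n (ω - s) = expo ω (-n) s := by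
  have hω' : (ω : ℂ) ≠ 0 := by exact_mod_cast hω
  rw [expo, expo, Complex.exp_eq_exp_iff_exists_int]
  refine ⟨-n, ?_⟩
  push_cast
  field_simp
  ring

theorem expo_period {ω : ℝ} (hω : ω ≠ 0) (n : ℤ) : expo ω n ω = 1 := by
  simpa using expo_sub hω n 0

theorem conj_expo (ω : ℝ) (n : ℤ) (s : ℝ) : (starRingEnd ℂ) (expo ω n s) = expo ω (-n) s := by
  rw [expo, expo, ← Complex.exp_conj]
  congr 1
  simp [Complex.conj_ofNat]

theorem hasDerivAt_expo (ω : ℝ) (n : ℤ) (s : ℝ) :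
    HasDerivAt (expo ω n) (-(Complex.I * ↑(2 * Real.pi / ω) * n) * expo ω n s) s := by
  have h1 : HasDerivAt (fun s : ℝ => -(2 * Real.pi * Complex.I * n / ω) * (s : ℂ))
      (-(Complex.I * ↑(2 * Real.pi / ω) * n)) s := by
    refine ((HasDerivAt.ofReal_comp (hasDerivAt_id s)).const_mul
      (-(2 * Real.pi * Complex.I * n / ω))).congr_deriv ?_
    push_cast
    ring
  rw [mul_comm]
  exact h1.cexp

end Exponentials

section Measure

variable {E : Type*} [NormedAddCommGroup E] {ω : ℝ} (hω : 0 < ω)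

include hω in
theorem restrict_absolutelyContinuous_normMeasure :
    (volume : Measure ℝ).restrict (Icc 0 ω) ≪ normMeasure ω :=
  Measure.absolutelyContinuous_smul (c := ((Real.toNNReal ω⁻¹ : NNReal) : ENNReal))
    (by simpa using hω)

theorem normMeasure_absolutelyContinuous_restrict (ω : ℝ) :
    normMeasure ω ≪ (volume : Measure ℝ).restrict (Icc 0 ω) :=
  Measure.smul_absolutelyContinuous (c := ((Real.toNNReal ω⁻¹ : NNReal) : ENNReal))

theorem ae_mem_Icc_normMeasure (ω : ℝ) : ∀ᵐ s ∂normMeasure ω, s ∈ Icc 0 ω :=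
  (normMeasure_absolutelyContinuous_restrict ω).ae_le (ae_restrict_mem measurableSet_Icc)

include hω in
theorem integral_normMeasure [NormedSpace ℝ E] (f : ℝ → E) :
    ∫ s, f s ∂normMeasure ω = ω⁻¹ • ∫ s in (0 : ℝ)..ω, f s := by
  rw [normMeasure, integral_smul_nnreal_measure, NNReal.smul_def,
    Real.coe_toNNReal _ (inv_nonneg.2 hω.le), integral_Icc_eq_integral_Ioc,
    intervalIntegral.integral_of_le hω.le]

include hω in
theorem isProbabilityMeasure_normMeasure : IsProbabilityMeasure (normMeasure ω) := by
  constructor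
  rw [normMeasure, Measure.smul_apply, Measure.restrict_apply_univ, Real.volume_Icc, sub_zero,
    ENNReal.smul_def, smul_eq_mul]
  change ENNReal.ofReal ω⁻¹ * ENNReal.ofReal ω = 1
  rw [← ENNReal.ofReal_mul (inv_nonneg.2 hω.le), inv_mul_cancel₀ hω.ne', ENNReal.ofReal_one]

include hω in
theorem eqOn_Icc_of_ae_eq_normMeasure {f g : ℝ → E} (h : f =ᵐ[normMeasure ω] g)
    (hf : ContinuousOn f (Icc 0 ω)) (hg : ContinuousOn g (Icc 0 ω)) : EqOn f g (Icc 0 ω) :=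
  Measure.eqOn_Icc_of_ae_eq volume hω.ne
    ((restrict_absolutelyContinuous_normMeasure hω).ae_eq h) hf hg

theorem memLp_of_continuousOn_Icc {f : ℝ → E} (hf : ContinuousOn f (Icc 0 ω)) :
    MemLp f 2 (normMeasure ω) := by
  obtain ⟨C, hC⟩ := isCompact_Icc.exists_bound_of_continuousOn hf
  have h1 : AEStronglyMeasurable f (normMeasure ω) :=
    (hf.aestronglyMeasurable measurableSet_Icc).mono_ac
      (normMeasure_absolutelyContinuous_restrict ω)
  exact .of_bound h1 C ((ae_mem_Icc_normMeasure ω).mono hC)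

end Measure

/-! ### Integration by parts and Fourier coefficients -/

section ByParts

variable {E : Type*} [NormedAddCommGroup E] [NormedSpace ℂ E] [CompleteSpace E]

/-- Integration by parts for the indefinite integral of an integrable function. -/
theorem integral_smul_eq_sub_of_primitive {ω : ℝ} (hω : 0 ≤ ω) {e e' : ℝ → ℂ}
    (he : ∀ s, HasDerivAt e (e' s) s) (he' : Continuous e') {f g : ℝ → E}
    (hg : IntervalIntegrable g volume 0 ω)
    (hf : ∀ s ∈ Icc 0 ω, f s = f 0 + ∫ τ in (0 : ℝ)..s, g τ) :
    ∫ s in (0 : ℝ)..ω, e s • g s =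
      e ω • f ω - e 0 • f 0 - ∫ s in (0 : ℝ)..ω, e' s • f s := by
  have hec : Continuous e := continuous_iff_continuousAt.2 fun s => (he s).continuousAt
  set ν := (volume : Measure ℝ).restrict (Ioc 0 ω) with hν
  have hgν : Integrable g ν := (intervalIntegrable_iff_integrableOn_Ioc_of_le hω).1 hg
  have he'ν : Integrable e' ν :=
    (intervalIntegrable_iff_integrableOn_Ioc_of_le hω).1 (he'.intervalIntegrable 0 ω)
  have hset : MeasurableSet {p : ℝ × ℝ | p.2 < p.1} := measurableSet_lt measurable_snd measurable_fst
  -- The formula is Fubini for e'(s) g(τ) on the triangle τ < s, which needs only integrability of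
  -- g.
  have hint : Integrable ({p : ℝ × ℝ | p.2 < p.1}.indicator fun p => e' p.1 • g p.2) (ν.prod ν) :=
    (he'ν.smul_prod hgν).indicator hset
  have hF := integral_integral_swap
    (f := fun s τ => {p : ℝ × ℝ | p.2 < p.1}.indicator (fun p => e' p.1 • g p.2) (s, τ)) hint
  have hleft (s : ℝ) (hs : s ∈ Ioc 0 ω) :
      ∫ τ, {p : ℝ × ℝ | p.2 < p.1}.indicator (fun p => e' p.1 • g p.2) (s, τ) ∂ν =
        e' s • f s - e' s • f 0 := by
    have h1 (τ : ℝ) : {p : ℝ × ℝ | p.2 < p.1}.indicator (fun p => e' p.1 • g p.2) (s, τ) =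
        (Iio s).indicator (fun τ => e' s • g τ) τ := rfl
    simp_rw [h1]
    rw [integral_indicator measurableSet_Iio, hν, Measure.restrict_restrict measurableSet_Iio,
      show Iio s ∩ Ioc 0 ω = Ioo 0 s by ext τ; simp only [mem_inter_iff, mem_Iio, mem_Ioc, mem_Ioo]
                                        grind [hs.2],
      integral_smul, ← integral_Ioc_eq_integral_Ioo, ← intervalIntegral.integral_of_le hs.1.le,
      hf s ⟨hs.1.le, hs.2⟩, smul_add, add_sub_cancel_left]
  have hright (τ : ℝ) (hτ : τ ∈ Ioc 0 ω) :
      ∫ s, {p : ℝ × ℝ | p.2 < p.1}.indicator (fun p => e' p.1 • g p.2) (s, τ) ∂ν =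
        e ω • g τ - e τ • g τ := by
    have h1 (s : ℝ) : {p : ℝ × ℝ | p.2 < p.1}.indicator (fun p => e' p.1 • g p.2) (s, τ) =
        (Ioi τ).indicator (fun s => e' s • g τ) s := rfl
    simp_rw [h1]
    rw [integral_indicator measurableSet_Ioi, hν, Measure.restrict_restrict measurableSet_Ioi,
      show Ioi τ ∩ Ioc 0 ω = Ioc τ ω by ext s; simp only [mem_inter_iff, mem_Ioi, mem_Ioc]
                                        grind [hτ.1],
      integral_smul_const, ← intervalIntegral.integral_of_le hτ.2,
      intervalIntegral.integral_eq_sub_of_hasDerivAt (fun s _ => he s)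
        (he'.intervalIntegrable _ _), sub_smul]
  rw [hν, setIntegral_congr_fun measurableSet_Ioc hleft,
    setIntegral_congr_fun measurableSet_Ioc hright, ← intervalIntegral.integral_of_le hω,
    ← intervalIntegral.integral_of_le hω] at hF
  have hfc : ContinuousOn f (uIcc 0 ω) := by
    have h1 := intervalIntegral.continuousOn_primitive_interval' hg left_mem_uIcc
    rw [uIcc_of_le hω] at h1 ⊢
    exact (continuousOn_const.add h1).congr hf
  have hi1 : IntervalIntegrable (fun s => e' s • f s) volume 0 ω :=
    (he'.continuousOn.smul hfc).intervalIntegrable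
  have hi2 : IntervalIntegrable (fun s => e' s • f 0) volume 0 ω :=
    (he'.smul continuous_const).intervalIntegrable _ _
  have hi3 : IntervalIntegrable (fun s => e s • g s) volume 0 ω :=
    hg.continuousOn_smul hec.continuousOn
  have hi4 : IntervalIntegrable (fun s => e ω • g s) volume 0 ω := hg.smul (e ω)
  rw [intervalIntegral.integral_sub hi1 hi2, intervalIntegral.integral_sub hi4 hi3,
    intervalIntegral.integral_smul_const, intervalIntegral.integral_smul,
    intervalIntegral.integral_eq_sub_of_hasDerivAt (fun s _ => he s)
      (he'.intervalIntegrable _ _)] at hF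
  rw [← sub_sub_cancel (e ω • ∫ s in (0 : ℝ)..ω, g s) (∫ s in (0 : ℝ)..ω, e s • g s), ← hF,
    hf ω ⟨hω, le_rfl⟩, smul_add, sub_smul]
  abel

end ByParts

section Coefficients

variable {H : Type*} [NormedAddCommGroup H] [InnerProductSpace ℂ H] {ω : ℝ}

/-- The Fourier coefficient of an `H`-valued function. -/
def fourierCoeff (ω : ℝ) (f : ℝ → H) (n : ℤ) : H := ∫ s, expo ω n s • f s ∂normMeasure ω

theorem fourierCoeff_congr {f g : ℝ → H} (h : f =ᵐ[normMeasure ω] g) (n : ℤ) :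
    fourierCoeff ω f n = fourierCoeff ω g n :=
  integral_congr_ae (h.mono fun s hs => by simp only [hs])

theorem integrable_expo_smul_of_integrable {f : ℝ → H} (hf : Integrable f (normMeasure ω)) (n : ℤ) :
    Integrable (fun s => expo ω n s • f s) (normMeasure ω) :=
  hf.bdd_smul 1 (continuous_expo ω n).aestronglyMeasurable
    (Eventually.of_forall fun s => (norm_expo ω n s).le)

theorem memLp_expo_smul {f : ℝ → H} (hf : MemLp f 2 (normMeasure ω)) (n : ℤ) :
    MemLp (fun s => expo ω n s • f s) 2 (normMeasure ω) :=
  hf.of_le ((continuous_expo ω n).aestronglyMeasurable.smul hf.1)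
    (Eventually.of_forall fun s => by rw [norm_smul, norm_expo, one_mul])

theorem fourierCoeff_sub {f g : ℝ → H} (hf : Integrable f (normMeasure ω))
    (hg : Integrable g (normMeasure ω)) (n : ℤ) :
    fourierCoeff ω (fun s => f s - g s) n = fourierCoeff ω f n - fourierCoeff ω g n := by
  rw [fourierCoeff, fourierCoeff, fourierCoeff, ← integral_sub
    (integrable_expo_smul_of_integrable hf n) (integrable_expo_smul_of_integrable hg n)]
  simp_rw [smul_sub]

theorem fourierCoeff_expo_smul (f : ℝ → H) (m n : ℤ) :
    fourierCoeff ω (fun s => expo ω m s • f s) n = fourierCoeff ω f (n + m) := by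
  simp_rw [fourierCoeff, smul_smul, expo_mul]

variable [CompleteSpace H] (hω : 0 < ω)

include hω in
/-- Fourier coefficients of the derivative of a periodic Sobolev function. -/
theorem HasSobolevDeriv.fourierCoeff_deriv {f g : ℝ → H} (h : HasSobolevDeriv ω f g)
    (hp : f 0 = f ω) (n : ℤ) :
    fourierCoeff ω g n = (Complex.I * ↑(2 * Real.pi / ω) * n) • fourierCoeff ω f n := by
  have hparts := integral_smul_eq_sub_of_primitive hω.le (hasDerivAt_expo ω n)
    (continuous_const.mul (continuous_expo ω n))
    (intervalIntegrable_of_memLp h.memLp (right_mem_Icc.2 hω.le)) h.eq_integral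
  rw [fourierCoeff, fourierCoeff, integral_normMeasure hω, integral_normMeasure hω, hparts,
    expo_period hω.ne', expo_apply_zero, hp, sub_self, zero_sub]
  simp_rw [mul_smul (-(Complex.I * ↑(2 * Real.pi / ω) * n))]
  rw [intervalIntegral.integral_smul, neg_smul, neg_neg, smul_comm]

include hω in
-- For n ≠ 0, a constant is periodic with zero derivative, so the derivative formula annihilates its
-- coefficient.
theorem fourierCoeff_const (x : H) (n : ℤ) :
    fourierCoeff ω (fun _ => x) n = if n = 0 then x else 0 := by
  have := isProbabilityMeasure_normMeasure hω
  split_ifs with hn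
  · simp [fourierCoeff, hn]
  · have h : HasSobolevDeriv ω (fun _ => x) 0 := ⟨MemLp.zero, fun s _ => by simp⟩
    have h1 := h.fourierCoeff_deriv hω rfl n
    have h2 : fourierCoeff ω (0 : ℝ → H) n = 0 := by simp [fourierCoeff]
    rw [h2, eq_comm, smul_eq_zero] at h1
    refine h1.resolve_left ?_
    have hπ : (Real.pi : ℂ) ≠ 0 := by exact_mod_cast Real.pi_ne_zero
    have hω' : (ω : ℂ) ≠ 0 := by exact_mod_cast hω.ne'
    simp [hn, hπ, hω']

include hω in
/-- A function all of whose Fourier coefficients vanish is zero almost everywhere. -/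
theorem ae_eq_zero_of_fourierCoeff {f : ℝ → H}
    (hf : Integrable f (normMeasure ω)) (h : ∀ n, fourierCoeff ω f n = 0) :
    f =ᵐ[normMeasure ω] 0 := by
  have : Fact (0 < ω) := ⟨hω⟩
  have hint (φ : C(AddCircle ω, ℂ)) : Integrable (fun s : ℝ => φ s • f s) (normMeasure ω) :=
    hf.bdd_smul ‖φ‖
      ((φ.continuous.comp (AddCircle.continuous_mk' ω)).aestronglyMeasurable)
      (Eventually.of_forall fun s => φ.norm_coe_le_norm _)
  -- Pairing with f is bounded for the sup norm and vanishes on the exponentials, whose span is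
  -- dense. It therefore vanishes on test functions supported in (0, ω), which extend periodically.
  let Λ : C(AddCircle ω, ℂ) →L[ℂ] H := LinearMap.mkContinuous
    { toFun := fun φ => ∫ s, φ (s : AddCircle ω) • f s ∂normMeasure ω
      map_add' := fun φ ψ => by
        simp_rw [ContinuousMap.add_apply, add_smul]
        exact integral_add (hint φ) (hint ψ)
      map_smul' := fun c φ => by
        simp_rw [ContinuousMap.smul_apply, smul_assoc]
        exact integral_smul c _ } (∫ s, ‖f s‖ ∂normMeasure ω) fun φ => by
    refine (norm_integral_le_of_norm_le (hf.norm.const_mul ‖φ‖)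
      (Eventually.of_forall fun s => ?_)).trans_eq ?_
    · rw [norm_smul]
      gcongr
      exact φ.norm_coe_le_norm _
    · rw [integral_const_mul, mul_comm]
  have hΛ : Λ = 0 := by
    refine ContinuousLinearMap.ext_on (s := range (fourier (T := ω))) ?_ ?_
    · rw [dense_iff_closure_eq, ← Submodule.topologicalClosure_coe, span_fourier_closure_eq_top]
      rfl
    · rintro _ ⟨n, rfl⟩
      rw [zero_apply, ← h (-n)]
      refine integral_congr_ae (Eventually.of_forall fun s => ?_)
      simp only [fourier_coe_apply, expo]
      congr 2
      push_cast
      ring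
  have hloc : LocallyIntegrableOn f (Ioo 0 ω) volume := by
    have h1 : IntervalIntegrable f volume 0 ω := by
      rw [intervalIntegrable_iff_integrableOn_Icc_of_le hω.le]
      exact (integrable_smul_measure (c := ((Real.toNNReal ω⁻¹ : NNReal) : ENNReal))
        (by simpa using hω) (by simp)).1 hf
    exact (((intervalIntegrable_iff_integrableOn_Ioo_of_le hω.le).1 h1)).locallyIntegrableOn
  have key := isOpen_Ioo.ae_eq_zero_of_integral_contDiff_smul_eq_zero hloc fun g hg _ hgs => by
    have hg0 (s : ℝ) (hs : s ∉ Ioo 0 ω) : g s = 0 :=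
      image_eq_zero_of_notMem_tsupport fun h => hs (hgs h)
    let φ : C(AddCircle ω, ℂ) := ⟨AddCircle.liftIco ω 0 fun s => (g s : ℂ),
      AddCircle.liftIco_zero_continuous (by simp [hg0])
        (Complex.continuous_ofReal.comp hg.continuous).continuousOn⟩
    have h1 : Λ φ = 0 := by rw [hΛ]; rfl
    have h2 : ∫ s in (0 : ℝ)..ω, φ (s : AddCircle ω) • f s = 0 := by
      have h3 : Λ φ = ω⁻¹ • ∫ s in (0 : ℝ)..ω, φ (s : AddCircle ω) • f s :=
        integral_normMeasure hω _
      rw [h1, eq_comm, smul_eq_zero] at h3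
      exact h3.resolve_left (inv_ne_zero hω.ne')
    rw [intervalIntegral.integral_of_le hω.le, integral_Ioc_eq_integral_Ioo] at h2
    rw [← h2, ← setIntegral_eq_integral_of_forall_compl_eq_zero (s := Ioo 0 ω)
      fun s hs => by rw [hg0 s hs, zero_smul]]
    refine setIntegral_congr_fun measurableSet_Ioo fun s hs => ?_
    have h4 : φ (s : AddCircle ω) = (g s : ℂ) :=
      AddCircle.liftIco_zero_coe_apply (f := fun s => (g s : ℂ)) ⟨hs.1.le, hs.2⟩
    simp only [h4]
    exact (algebraMap_smul ℂ (g s) (f s)).symm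
  refine (normMeasure_absolutelyContinuous_restrict ω).ae_eq ?_
  rw [← Measure.restrict_congr_set Ioo_ae_eq_Icc]
  exact (ae_restrict_iff' measurableSet_Ioo).2 key

end Coefficients

/-! ### The vector-valued Fourier transform -/

section FourierEquiv

variable {H : Type*} [NormedAddCommGroup H] [InnerProductSpace ℂ H] {ω : ℝ}

theorem memLp_mode (ω : ℝ) (n : ℤ) (x : H) :
    MemLp (fun s => expo ω (-n) s • x) 2 (normMeasure ω) :=
  memLp_expo_smul (memLp_const x) (-n)

/-- Testing against x ∈ H reads off Fourier coefficients weakly; orthogonality and completeness of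
the modes both reduce to this. -/
theorem inner_toLp_mode [CompleteSpace H] (n : ℤ) (x : H) (f : L2 ω H) :
    inner ℂ ((memLp_mode ω n x).toLp _) f = inner ℂ x (fourierCoeff ω f n) := by
  rw [L2.inner_def, fourierCoeff, ← integral_inner
    (integrable_expo_smul_of_integrable ((Lp.memLp f).integrable (by norm_num)) n)]
  refine integral_congr_ae ?_
  filter_upwards [(memLp_mode ω n x).coeFn_toLp] with s hs
  rw [hs, inner_smul_left, conj_expo, neg_neg, inner_smul_right]

variable [CompleteSpace H] (hω : 0 < ω)

include hω in
theorem fourierCoeff_mode (n m : ℤ) (x : H) :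
    fourierCoeff ω (fun s => expo ω (-n) s • x) m = if m = n then x else 0 := by
  rw [fourierCoeff_expo_smul, fourierCoeff_const hω]
  simp [← sub_eq_add_neg, sub_eq_zero]

include hω in
theorem inner_toLp_mode_mode (n m : ℤ) (x y : H) :
    inner ℂ ((memLp_mode ω n x).toLp _) ((memLp_mode ω m y).toLp _) =
      inner ℂ x (if n = m then y else 0) := by
  rw [inner_toLp_mode, fourierCoeff_congr (memLp_mode ω m y).coeFn_toLp, fourierCoeff_mode hω]

/-- The embedding `x ↦ exp (2πi n · / ω) x` of `H` into `L²([0, ω], H)`. -/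
def mode (n : ℤ) : H →ₗᵢ[ℂ] L2 ω H :=
  LinearMap.isometryOfInner
    { toFun := fun x => (memLp_mode ω n x).toLp _
      map_add' := fun x y => by
        rw [← MemLp.toLp_add]
        congr 1
        funext s
        simp
      map_smul' := fun c x => by
        rw [RingHom.id_apply, ← MemLp.toLp_const_smul]
        congr 1
        funext s
        simp [smul_comm c] } fun x y => by
    simpa using inner_toLp_mode_mode hω n n x y

theorem mode_apply (n : ℤ) (x : H) : mode hω n x = (memLp_mode ω n x).toLp _ := rfl

theorem orthogonalFamily_mode : OrthogonalFamily ℂ (fun _ : ℤ => H) (mode (H := H) hω) := by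
  intro n m hnm x y
  rw [mode_apply, mode_apply, inner_toLp_mode_mode hω, if_neg hnm, inner_zero_right]

theorem isHilbertSum_mode : IsHilbertSum ℂ (fun _ : ℤ => H) (mode (H := H) hω) := by
  refine .mk (orthogonalFamily_mode hω) (top_le_iff.2 ?_)
  rw [Submodule.topologicalClosure_eq_top_iff, eq_bot_iff]
  intro f hf
  rw [Submodule.mem_bot]
  refine (Lp.eq_zero_iff_ae_eq_zero).2 (ae_eq_zero_of_fourierCoeff hω
    ((Lp.memLp f).integrable (by norm_num)) fun n => ?_)
  refine ext_inner_left ℂ fun x => ?_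
  rw [inner_zero_right, ← inner_toLp_mode]
  exact (Submodule.mem_orthogonal _ _).1 hf _
    (Submodule.mem_iSup_of_mem n (LinearMap.mem_range_self _ x))

/-- The Fourier transform `L²([0, ω], H) ≃ ℓ²(ℤ, H)`. -/
def fourierEquiv : L2 ω H ≃ₗᵢ[ℂ] Ell2 H := (isHilbertSum_mode hω).linearIsometryEquiv

theorem fourierEquiv_apply (f : L2 ω H) (n : ℤ) : fourierEquiv hω f n = fourierCoeff ω f n := by
  refine ext_inner_left ℂ fun x => ?_
  rw [← inner_toLp_mode, ← lp.inner_single_left (𝕜 := ℂ) n x (fourierEquiv hω f),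
    ← (fourierEquiv hω).symm.inner_map_map, LinearIsometryEquiv.symm_apply_apply, fourierEquiv,
    IsHilbertSum.linearIsometryEquiv_symm_apply_single, mode_apply]

theorem fourierEquiv_toLp {f : ℝ → H} (hf : MemLp f 2 (normMeasure ω)) (n : ℤ) :
    fourierEquiv hω (hf.toLp f) n = fourierCoeff ω f n := by
  rw [fourierEquiv_apply, fourierCoeff_congr hf.coeFn_toLp]

include hω in
theorem eq_of_fourierCoeff {f g : L2 ω H}
    (h : ∀ n, fourierCoeff ω f n = fourierCoeff ω g n) : f = g :=
  (fourierEquiv hω).injective (by ext n; rw [fourierEquiv_apply, fourierEquiv_apply, h])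

end FourierEquiv

/-! ### Periodic Sobolev functions and their Fourier series -/

section Sobolev

variable {H : Type*} [NormedAddCommGroup H] [InnerProductSpace ℂ H] [CompleteSpace H] {ω : ℝ}
  (hω : 0 < ω)

omit [CompleteSpace H] in
include hω in
theorem HasSobolevDeriv.continuousOn {f g : ℝ → H} (h : HasSobolevDeriv ω f g) :
    ContinuousOn f (Icc 0 ω) := by
  have h1 := intervalIntegral.continuousOn_primitive_interval'
    (intervalIntegrable_of_memLp h.memLp (right_mem_Icc.2 hω.le)) left_mem_uIcc
  rw [uIcc_of_le hω.le] at h1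
  exact (continuousOn_const.add h1).congr h.eq_integral

/-- A sequence `x` with `(iθn x(n)) ∈ ℓ²` is the sequence of Fourier coefficients of a periodic
Sobolev function. -/
theorem exists_hasSobolevDeriv {y : L2 ω H} {w : Ell2 H} (hw : ∀ n : ℤ,
      w n = (Complex.I * ↑(2 * Real.pi / ω) * n) • fourierEquiv hω y n) :
    ∃ f g : ℝ → H, HasSobolevDeriv ω f g ∧ f 0 = f ω ∧ y =ᵐ[normMeasure ω] f ∧
      ∀ n, fourierCoeff ω g n = w n := by
  set g : L2 ω H := (fourierEquiv hω).symm w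
  have hgn (n : ℤ) : fourierCoeff ω g n = w n := by
    rw [← fourierEquiv_apply hω, LinearIsometryEquiv.apply_symm_apply]
  -- The factor n makes w(0) = 0, so g has mean zero and its primitive is periodic.
  have hg0 : ∫ τ in (0 : ℝ)..ω, g τ = 0 := by
    have h1 := hgn 0
    rw [hw, fourierCoeff, integral_normMeasure hω] at h1
    simpa [hω.ne'] using h1
  set f₁ : ℝ → H := fun s => ∫ τ in (0 : ℝ)..s, g τ
  have hf₁ : HasSobolevDeriv ω f₁ g := ⟨Lp.memLp g, fun s _ => by simp [f₁]⟩
  -- The derivative does not determine the zeroth coefficient; this constant adjusts it.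
  set c : H := fourierEquiv hω y 0 - fourierCoeff ω f₁ 0
  have hf : HasSobolevDeriv ω (fun s => f₁ s + c) g := ⟨Lp.memLp g, fun s _ => by simp [f₁, add_comm]⟩
  have hp : f₁ 0 + c = f₁ ω + c := by simp [f₁, hg0]
  refine ⟨fun s => f₁ s + c, g, hf, hp, ?_, hgn⟩
  have hfm := memLp_of_continuousOn_Icc (hf.continuousOn hω)
  have hy : y = hfm.toLp _ := by
    refine (fourierEquiv hω).injective ?_
    ext n
    rw [fourierEquiv_toLp]
    by_cases hn : n = 0
    · subst hn
      have := isProbabilityMeasure_normMeasure hω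
      have hi := (memLp_of_continuousOn_Icc (hf₁.continuousOn hω)).integrable (by norm_num)
      have h1 := fourierCoeff_sub hi (integrable_const (-c)) 0
      simp only [sub_neg_eq_add] at h1
      rw [h1, fourierCoeff_const hω, if_pos rfl]
      simp [c]
    · have h1 := hf.fourierCoeff_deriv hω hp n
      rw [hgn, hw] at h1
      have hπ : (Real.pi : ℂ) ≠ 0 := by exact_mod_cast Real.pi_ne_zero
      have hω' : (ω : ℂ) ≠ 0 := by exact_mod_cast hω.ne'
      refine smul_right_injective H (r := Complex.I * ↑(2 * Real.pi / ω) * n) ?_ h1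
      simp [hn, hπ, hω']
  rw [hy]
  exact hfm.coeFn_toLp

include hω in
/-- A continuous function with summable Fourier coefficients is the sum of its Fourier series. -/
theorem hasSum_fourierSeries {f : ℝ → H} (hf : ContinuousOn f (Icc 0 ω))
    (hs : Summable fun n => ‖fourierCoeff ω f n‖) {s : ℝ} (hsI : s ∈ Icc 0 ω) :
    HasSum (fun n => expo ω (-n) s • fourierCoeff ω f n) (f s) := by
  have hle (n : ℤ) (s : ℝ) : ‖expo ω (-n) s • fourierCoeff ω f n‖ ≤ ‖fourierCoeff ω f n‖ := by
    rw [norm_smul, norm_expo, one_mul]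
  -- The uniform limit is continuous and has the coefficients of f, so the two agree almost
  -- everywhere, hence at every point of [0, ω].
  set h : ℝ → H := fun s => ∑' n, expo ω (-n) s • fourierCoeff ω f n
  have hcont : Continuous h :=
    continuous_tsum (fun n => (continuous_expo ω (-n)).smul continuous_const) hs hle
  have hfm := memLp_of_continuousOn_Icc hf
  have hhm : MemLp h 2 (normMeasure ω) := memLp_of_continuousOn_Icc hcont.continuousOn
  have hcoef (m : ℤ) : fourierCoeff ω h m = fourierCoeff ω f m := by
    have hint (n : ℤ) : Integrable (fun s => expo ω m s • expo ω (-n) s • fourierCoeff ω f n)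
        (normMeasure ω) := integrable_expo_smul_of_integrable
          (integrable_expo_smul_of_integrable (integrable_const _) _) _
    have hnorm (n : ℤ) :
        ∫ s, ‖expo ω m s • expo ω (-n) s • fourierCoeff ω f n‖ ∂normMeasure ω =
          ‖fourierCoeff ω f n‖ := by
      have := isProbabilityMeasure_normMeasure hω
      simp [norm_smul, norm_expo]
    have h1 := integral_tsum_of_summable_integral_norm hint (by simpa only [hnorm] using hs)
    have h2 (n : ℤ) : ∫ s, expo ω m s • expo ω (-n) s • fourierCoeff ω f n ∂normMeasure ω =
        if n = m then fourierCoeff ω f n else 0 := by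
      refine (fourierCoeff_mode hω n m (fourierCoeff ω f n)).trans ?_
      simp only [eq_comm]
    have h3 (s : ℝ) : ∑' n, expo ω m s • expo ω (-n) s • fourierCoeff ω f n = expo ω m s • h s :=
      ((hs.of_norm_bounded fun n => hle n s).tsum_const_smul _)
    simp_rw [h2, h3] at h1
    rw [fourierCoeff, ← h1, tsum_ite_eq]
  have hae : h =ᵐ[normMeasure ω] f := by
    have : hhm.toLp h = hfm.toLp f := eq_of_fourierCoeff hω fun n => by
      rw [fourierCoeff_congr hhm.coeFn_toLp, fourierCoeff_congr hfm.coeFn_toLp, hcoef]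
    exact MemLp.toLp_eq_toLp_iff hhm hfm |>.1 this
  rw [← eqOn_Icc_of_ae_eq_normMeasure hω hae hcont.continuousOn hf hsI]
  exact (hs.of_norm_bounded fun n => hle n s).hasSum

end Sobolev

/-! ### The operator in Fourier coordinates -/

section Product

variable {H : Type*} [NormedAddCommGroup H] [InnerProductSpace ℂ H] [CompleteSpace H] {ω : ℝ}
  (hω : 0 < ω) {V : ℝ → H →L[ℂ] H} (hV : IsPotential ω V)
  (hsq : Summable fun n : ℤ => ‖potCoeff hV n‖ ^ 2)

include hω hsq in
/-- The function `s ↦ V(s) f(ω - s)` is square integrable, and its Fourier coefficients are given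
by the Hankel matrix of the Fourier coefficients of the potential. -/
theorem memLp_potential_reflect {f : ℝ → H} (hf : ContinuousOn f (Icc 0 ω))
    (hs : Summable fun n => ‖fourierCoeff ω f n‖) :
    MemLp (fun s => V s (f (ω - s))) 2 (normMeasure ω) ∧
      ∀ n, fourierCoeff ω (fun s => V s (f (ω - s))) n =
        ∑' m, potCoeff hV (n + m) (fourierCoeff ω f m) := by
  set c : ℤ → H := fourierCoeff ω f
  have hk (m : ℤ) : MemLp (fun s => expo ω m s • V s (c m)) 2 (normMeasure ω) :=
    memLp_expo_smul (hV (c m)) m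
  -- Only functions V(·)x with fixed x are controlled, so f(ω - s) is expanded in its Fourier
  -- series. The resulting terms converge absolutely in L².
  set Y : ℤ → L2 ω H := fun m => (hk m).toLp _
  have hY (m n : ℤ) : fourierEquiv hω (Y m) n = potCoeff hV (n + m) (c m) := by
    rw [fourierEquiv_toLp, fourierCoeff_expo_smul]
    rfl
  have hYn : Summable fun m => ‖Y m‖ :=
    .of_nonneg_of_le (fun _ => norm_nonneg _)
      (fun m => (LinearIsometryEquiv.norm_map (fourierEquiv hω) (Y m)).symm.trans_le
        (norm_hankel_col_le hsq (hY m))) (hs.mul_left _)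
  -- The Fourier series of f converges at every point of [0, ω] and each V(s) is continuous, so the
  -- L² sum is the product almost everywhere. This also supplies its measurability.
  have hp : ((∑' m, Y m : L2 ω H) : ℝ → H) =ᵐ[normMeasure ω] fun s => V s (f (ω - s)) := by
    have hYe : ∑' m, ‖Y m‖ₑ ≠ ⊤ := by
      simpa only [ofReal_norm] using hYn.tsum_ofReal_ne_top
    filter_upwards [Lp.hasSum_coeFn_tsum hYe, ae_mem_Icc_normMeasure ω,
      ae_all_iff.2 fun m => (hk m).coeFn_toLp] with s h1 h2 h3
    refine h1.unique ?_
    have h4 := (hasSum_fourierSeries hω hf hs (s := ω - s)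
      ⟨by linarith [h2.2], by linarith [h2.1]⟩).mapL (V s)
    simp only [expo_sub hω.ne', neg_neg, map_smul] at h4
    exact (funext h3 : (fun m => Y m s) = _) ▸ h4
  refine ⟨(memLp_congr_ae hp).1 (Lp.memLp _), fun n => ?_⟩
  rw [← fourierCoeff_congr hp, ← fourierEquiv_apply hω, ← Ell2.eval_apply,
    ← LinearIsometryEquiv.coe_toContinuousLinearEquiv, ContinuousLinearEquiv.map_tsum,
    ContinuousLinearMap.map_tsum]
  · exact tsum_congr fun m => hY m n
  · exact ((fourierEquiv hω).toContinuousLinearEquiv.summable).2 hYn.of_norm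

theorem two_pi_div_ne_zero {ω : ℝ} (hω : 0 < ω) : 2 * Real.pi / ω ≠ 0 := by positivity

include hω in
theorem HasSobolevDeriv.summable_norm_fourierCoeff {f g : ℝ → H} (h : HasSobolevDeriv ω f g)
    (hp : f 0 = f ω) : Summable fun n => ‖fourierCoeff ω f n‖ := by
  have hf := memLp_of_continuousOn_Icc (h.continuousOn hω)
  have := (summable_norm_of_domain (x := fourierEquiv hω (hf.toLp f))
    (w := fourierEquiv hω (h.memLp.toLp g)) one_pos (two_pi_div_ne_zero hω) fun n => by
      rw [fourierEquiv_toLp, fourierEquiv_toLp, h.fourierCoeff_deriv hω hp]).1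
  simpa only [fourierEquiv_toLp] using this

include hω hsq in
/-- The graph of `L` in Fourier coordinates. -/
theorem mem_opGraph_iff (y z : L2 ω H) : (y, z) ∈ opGraph ω V ↔
    HankelGraph (2 * Real.pi / ω) (potCoeff hV) (fourierEquiv hω y) (fourierEquiv hω z) := by
  constructor
  · rintro ⟨f, g, h, hp, hy, hz⟩
    simp only at hy hz
    obtain ⟨hm, hc⟩ := memLp_potential_reflect hω hV hsq (h.continuousOn hω)
      (h.summable_norm_fourierCoeff hω hp)
    refine ⟨fourierEquiv hω (h.memLp.toLp g), fun n => ?_, fun n => ?_⟩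
    · rw [fourierEquiv_toLp, fourierEquiv_apply, fourierCoeff_congr hy,
        h.fourierCoeff_deriv hω hp]
    · rw [fourierEquiv_toLp, fourierEquiv_apply, fourierCoeff_congr hz,
        fourierCoeff_sub (h.memLp.integrable (by norm_num)) (hm.integrable (by norm_num)), hc]
      simp_rw [fourierEquiv_apply, fourierCoeff_congr hy]
  · rintro ⟨w, hw, hz⟩
    obtain ⟨f, g, h, hp, hy, hg⟩ := exists_hasSobolevDeriv hω hw
    obtain ⟨hm, hc⟩ := memLp_potential_reflect hω hV hsq (h.continuousOn hω)
      (h.summable_norm_fourierCoeff hω hp)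
    refine ⟨f, g, h, hp, hy, ?_⟩
    have hgm : MemLp (fun s => g s - V s (f (ω - s))) 2 (normMeasure ω) := h.memLp.sub hm
    have hzeq : z = hgm.toLp _ := eq_of_fourierCoeff hω fun n => by
      rw [fourierCoeff_congr hgm.coeFn_toLp,
        fourierCoeff_sub (h.memLp.integrable (by norm_num)) (hm.integrable (by norm_num)), hc, hg,
        ← fourierEquiv_apply hω, hz]
      simp_rw [fourierEquiv_apply, fourierCoeff_congr hy]
    simp only
    rw [hzeq]
    exact hgm.coeFn_toLp

include hω in
theorem mem_opL_graph_iff (y z : L2 ω H) :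
    (∃ hy : y ∈ (opL ω V).domain, opL ω V ⟨y, hy⟩ = z) ↔ (y, z) ∈ opGraph ω V := by
  rw [← opL_graph hω, LinearPMap.mem_graph_iff]
  constructor
  · rintro ⟨hy, h⟩
    exact ⟨⟨y, hy⟩, rfl, h⟩
  · rintro ⟨⟨y', hy'⟩, h1, h2⟩
    simp only at h1
    subst h1
    exact ⟨hy', h2⟩

include hω hV hsq in
-- A periodic Sobolev function has absolutely summable Fourier coefficients, so its potential term
-- is automatically square integrable.
theorem opL_domain_eq : (opL ω V).domain = periodicSobolev ω H := by
  ext y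
  rw [LinearPMap.mem_domain_iff, opL_graph hω]
  constructor
  · rintro ⟨z, f, g, h, hp, hy, -⟩
    exact ⟨f, g, h, hp, hy⟩
  · rintro ⟨f, g, h, hp, hy⟩
    have hgm := h.memLp.sub (memLp_potential_reflect hω hV hsq (h.continuousOn hω)
      (h.summable_norm_fourierCoeff hω hp)).1
    exact ⟨hgm.toLp _, f, g, h, hp, hy, hgm.coeFn_toLp⟩

include hω hsq in
/-- The operator `L` generates a strongly continuous group. -/
theorem exists_isGenerator_opL (hdbl : Summable fun p : ℤ × ℤ =>
      ‖∑' n : {n : ℤ // n ≠ p.2}, ((p.2 : ℂ) - ((n : ℤ) : ℂ))⁻¹ •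
        ((potCoeff hV (p.1 + n)).comp (potCoeff hV (p.2 + n)))‖ ^ 2) :
    ∃ T : ℝ → L2 ω H →L[ℂ] L2 ω H, IsC0Group T ∧ IsGenerator (opL ω V) T := by
  obtain ⟨S, hS, hSgen⟩ := exists_group_hankelGraph hsq (two_pi_div_ne_zero hω) hdbl
  obtain ⟨hT, hTd⟩ := hS.conj (Y := L2 ω H) (fourierEquiv hω).symm.toContinuousLinearEquiv
  refine ⟨_, hT, (isGenerator_iff hT _).2 fun x y => ?_⟩
  rw [hTd, hSgen, mem_opL_graph_iff hω, mem_opGraph_iff hω hV hsq]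
  rfl

end Product

/-! ### Solutions are orbits of the group -/

section Solutions

variable {X : Type*} [NormedAddCommGroup X] [NormedSpace ℂ X] [NormedSpace ℝ X]
  [IsScalarTower ℝ ℂ X] [CompleteSpace X] {A : X →ₗ.[ℂ] X} {T : ℝ → X →L[ℂ] X}

theorem IsTimeInterval.uIcc_subset {J : Set ℝ} (hJ : IsTimeInterval J) {t : ℝ} (ht : t ∈ J) :
    uIcc 0 t ⊆ J := by
  obtain ⟨h0, rfl | ⟨β, rfl⟩ | ⟨α, β, -, rfl⟩ | ⟨α, rfl⟩⟩ := hJ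
  · exact subset_univ _
  all_goals exact ordConnected_iff_uIcc_subset.1 inferInstance h0 ht

/-- A differentiable solution of `v' = Av` is an orbit of the group generated by `A`. -/
theorem IsGenerator.eq_orbit (hA : IsGenerator A T) (hT : IsC0Group T) {v : ℝ → X} {t : ℝ}
    (hv : ∀ r ∈ uIcc 0 t, ∃ hr : v r ∈ A.domain, HasDerivWithinAt v (A ⟨v r, hr⟩) (uIcc 0 t) r) :
    v t = T t (v 0) := by
  rw [isGenerator_iff hT] at hA
  have h1 (r : ℝ) : r ∈ uIcc 0 t → ∃ y, HasDerivAt (fun s => T s (v r)) y 0 ∧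
      HasDerivWithinAt v y (uIcc 0 t) r := fun hr => by
    obtain ⟨hd, h⟩ := hv r hr
    exact ⟨_, (hA _ _).1 ⟨hd, rfl⟩, h⟩
  choose! Av hAv hv' using h1
  simpa using hT.eq_of_hasDerivWithinAt (ψ := 0) (by simpa using hv') hAv

/-- A continuous solution of `v(t) = φ + A ∫₀ᵗ v` is an orbit of the group generated by `A`. -/
theorem IsGenerator.eq_orbit_of_integral (hA : IsGenerator A T) (hT : IsC0Group T) {v : ℝ → X}
    {t : ℝ} (φ : X) (hc : ContinuousOn v (uIcc 0 t))
    (hv : ∀ r ∈ uIcc 0 t, ∃ hr : (∫ τ in (0 : ℝ)..r, v τ) ∈ A.domain,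
      v r = φ + A ⟨∫ τ in (0 : ℝ)..r, v τ, hr⟩) :
    v t = T t φ := by
  rw [isGenerator_iff hT] at hA
  -- For t = 0 the interval degenerates to a point, where derivatives within it are not unique.
  rcases eq_or_ne t 0 with rfl | ht
  · obtain ⟨hr, h⟩ := hv 0 left_mem_uIcc
    have h0 : A ⟨∫ τ in (0 : ℝ)..0, v τ, hr⟩ = 0 := by
      rw [show (⟨∫ τ in (0 : ℝ)..0, v τ, hr⟩ : A.domain) = 0 from
        Subtype.ext intervalIntegral.integral_same]
      exact A.map_zero
    rw [h, h0, add_zero, hT.zero_apply]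
  -- The primitive satisfies w' = Aw + φ with w(0) = 0, so variation of constants gives w(r) = ∫₀ʳ
  -- T(τ)φ dτ; differentiating at t recovers v(t) = T(t)φ.
  set w : ℝ → X := fun r => ∫ τ in (0 : ℝ)..r, v τ
  have hw (r : ℝ) (hr : r ∈ uIcc 0 t) : HasDerivWithinAt w (v r) (uIcc 0 t) r := by
    have : Fact (r ∈ Icc (min 0 t) (max 0 t)) := ⟨hr⟩
    exact intervalIntegral.integral_hasDerivWithinAt_right (s := Icc (min 0 t) (max 0 t))
      (t := Icc (min 0 t) (max 0 t))
      ((hc.mono (uIcc_subset_uIcc left_mem_uIcc hr)).intervalIntegrable)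
      (hc.stronglyMeasurableAtFilter_nhdsWithin measurableSet_uIcc r) (hc r hr)
  have h1 (r : ℝ) : r ∈ uIcc 0 t → ∃ y, HasDerivAt (fun s => T s (w r)) y 0 ∧
      v r = y + φ := fun hr => by
    obtain ⟨hd, h⟩ := hv r hr
    exact ⟨_, (hA _ _).1 ⟨hd, rfl⟩, h.trans (add_comm _ _)⟩
  choose! Aw hAw hvw using h1
  have h2 (r : ℝ) (hr : r ∈ uIcc 0 t) : w r = ∫ τ in (0 : ℝ)..r, T τ φ := by
    have hsub : uIcc 0 r ⊆ uIcc 0 t := uIcc_subset_uIcc left_mem_uIcc hr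
    simpa [w] using hT.eq_of_hasDerivWithinAt (w := w) (ψ := φ) (t := r)
      (fun ρ hρ => hvw ρ (hsub hρ) ▸ (hw ρ (hsub hρ)).mono hsub) fun ρ hρ => hAw ρ (hsub hρ)
  have h3 : HasDerivWithinAt w (T t φ) (uIcc 0 t) t :=
    (intervalIntegral.integral_hasDerivAt_right ((hT.continuous φ).intervalIntegrable 0 t)
      ((hT.continuous φ).stronglyMeasurableAtFilter _ _)
      (hT.continuous φ).continuousAt).hasDerivWithinAt.congr h2 (h2 t right_mem_uIcc)
  exact (uniqueDiffOn_Icc (inf_lt_sup.2 ht.symm) t right_mem_uIcc).eq_deriv _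
    (hw t right_mem_uIcc) h3

end Solutions

end Involution

theorem theorem2p1 {H : Type*} [NormedAddCommGroup H] [InnerProductSpace ℂ H] [CompleteSpace H]
    {ω : ℝ} (hω : 0 < ω) (V : ℝ → H →L[ℂ] H) (hV : Involution.IsPotential ω V)
    (hsq : Summable fun n : ℤ => ‖Involution.potCoeff hV n‖ ^ 2)
    (hdbl : Summable fun p : ℤ × ℤ =>
      ‖∑' n : {n : ℤ // n ≠ p.2}, ((p.2 : ℂ) - ((n : ℤ) : ℂ))⁻¹ •
        ((Involution.potCoeff hV (p.1 + n)).comp (Involution.potCoeff hV (p.2 + n)))‖ ^ 2) :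
    (Involution.opL ω V).domain = Involution.periodicSobolev ω H ∧
    ∃ T : ℝ → Involution.L2 ω H →L[ℂ] Involution.L2 ω H,
      Involution.IsC0Group T ∧ Involution.IsGenerator (Involution.opL ω V) T ∧
      ∀ J : Set ℝ, Involution.IsTimeInterval J →
        (∀ (φ : Involution.L2 ω H) (u : ℝ → ℝ → H), Involution.IsClassicalSolution ω V J φ u →
          φ ∈ Involution.periodicSobolev ω H ∧
          ∀ t ∈ J, u t =ᵐ[Involution.normMeasure ω] T t φ) ∧
        (∀ (φ : Involution.L2 ω H) (u : ℝ → ℝ → H), Involution.IsMildSolution ω V J φ u →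
          ∀ t ∈ J, u t =ᵐ[Involution.normMeasure ω] T t φ) := by
  have hdom := Involution.opL_domain_eq hω hV hsq
  obtain ⟨T, hT, hgen⟩ := Involution.exists_isGenerator_opL hω hV hsq hdbl
  refine ⟨hdom, T, hT, hgen, fun J hJ => ⟨fun φ u hu => ?_, fun φ u hu t ht => ?_⟩⟩
  · obtain ⟨-, v, ⟨-, huv⟩, -, hv, rfl⟩ := hu
    refine ⟨hdom ▸ (hv 0 hJ.1).1, fun t ht => ?_⟩
    rw [← hgen.eq_orbit hT fun r hr => (hv r (hJ.uIcc_subset ht hr)).imp fun _ h =>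
      h.mono (hJ.uIcc_subset ht)]
    exact (huv t ht).symm
  · obtain ⟨v, ⟨hc, huv⟩, hv⟩ := hu
    rw [← hgen.eq_orbit_of_integral hT φ (hc.mono (hJ.uIcc_subset ht)) fun r hr =>
      hv r (hJ.uIcc_subset ht hr)]
    exact (huv t ht).symm
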